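/- Let \(k\ge 6\) be an even integer. Then there exist a simple graph \(\Gamma\) on \(10k-8\) vertices and two disjoint non-empty sets \(X_1,X_2\) of vertices of \(\Gamma\), with \(Y\) the set of remaining vertices, such that: (a) For all \(i,j\in\{1,2\}\), all vertices of \(X_i\) have the same number of neighbours in \(X_j\); for each \(i\), every \(y\in Y\) is adjacent to \(0\), exactly \(\tfrac12|X_i|\), or all of the vertices of \(X_i\); and for each \(i\) at least one \(y\in Y\) is adjacent to exactly \(\tfrac12|X_i|\) vertices of \(X_i\). (b) Let \(\Gamma'\) be the graph obtained from \(\Gamma\) by Godsil–McKay switching with respect to \(X_1,X_2\): for each \(i\) and each \(y\in Y\) with exactly \(\tfrac12|X_i|\) neighbours in \(X_i\), delete the edges between \(y\) and \(X_i\) and join \(y\) instead to the other vertices of \(X_i\). Then \(\Gamma\) and \(\Gamma'\) are both \((3k-5)\)-regular, and their adjacency matrices have the same spectrum (eigenvalues with multiplicities). (c) The edge-connectivity of \(\Gamma\) is \(3k-5\) and the edge-connectivity of \(\Gamma'\) is \(3k-6\), where the edge-connectivity of a graph is the minimum number of edges one has to delete to make the graph disconnected. -/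

import Mathlib

open scoped Classical

/-- The spectrum of the adjacency matrix of a finite graph: the multiset of its eigenvalues,
each repeated according to its multiplicity. -/
noncomputable def adjSpectrum {V : Type*} [Fintype V] (G : SimpleGraph V) : Multiset ℂ :=
  (G.adjMatrix ℂ).charpoly.roots

/-- `n` is the edge-connectivity of `G`: the minimum number of edges of `G` one has to delete
to make the graph disconnected. -/
def IsEdgeConnectivity {V : Type*} (G : SimpleGraph V) (n : ℕ) : Prop :=
  IsLeast {c : ℕ | ∃ F : Finset (Sym2 V), (F : Set (Sym2 V)) ⊆ G.edgeSet ∧ F.card = c ∧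
    ¬ (G.deleteEdges (F : Set (Sym2 V))).Preconnected} n

/-- The number of neighbours of the vertex `v` in the set `S`. -/
noncomputable def nbrCount {V : Type*} (G : SimpleGraph V) (v : V) (S : Finset V) : ℕ :=
  (S.filter fun w => G.Adj v w).card

/-- The sets `X 0, …, X (m - 1)`, together with the set `Y` of the remaining vertices, form a
partition of the vertex set that satisfies the hypotheses of Godsil–McKay switching. -/
structure IsGMPartition {V : Type*} {m : ℕ} (G : SimpleGraph V) (X : Fin m → Finset V) :
    Prop where
  nonempty : ∀ i, (X i).Nonempty
  disjoint : ∀ i j, i ≠ j → Disjoint (X i) (X j)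
  equitable : ∀ i j, ∀ x ∈ X i, ∀ x' ∈ X i, nbrCount G x (X j) = nbrCount G x' (X j)
  half : ∀ i, ∀ y, (∀ j, y ∉ X j) →
    nbrCount G y (X i) = 0 ∨ 2 * nbrCount G y (X i) = (X i).card ∨
      nbrCount G y (X i) = (X i).card

/-- The edge/non-edge between `x` and `y` gets switched: `x` lies in some switching set `X i`,
`y` lies in none, and `y` is adjacent to exactly half of the vertices of `X i`. -/
def GMSwitched {V : Type*} {m : ℕ} (G : SimpleGraph V) (X : Fin m → Finset V) (x y : V) :
    Prop :=
  ∃ i, x ∈ X i ∧ (∀ j, y ∉ X j) ∧ 2 * nbrCount G y (X i) = (X i).card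

/-- Godsil–McKay switching: for every `i` and every `y` outside all switching sets that has
exactly `|X i| / 2` neighbours in `X i`, delete the edges from `y` to `X i`, and join `y` to the
other vertices of `X i`. -/
def gmSwitch {V : Type*} {m : ℕ} (G : SimpleGraph V) (X : Fin m → Finset V) :
    SimpleGraph V where
  Adj u v := Xor (G.Adj u v) (GMSwitched G X u v ∨ GMSwitched G X v u)
  symm := ⟨fun u v h => by
    rw [G.adj_comm v u, or_comm]
    exact h⟩
  loopless := ⟨fun u h => by
    rcases h with ⟨h, -⟩ | ⟨⟨i, h1, h2, -⟩ | ⟨i, h1, h2, -⟩, -⟩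
    · exact G.loopless.irrefl u h
    · exact h2 i h1
    · exact h2 i h1⟩

/-! Write k = m + 6 with m even, so that the degree is d = 3m + 13. The vertices form four blocks P,
Q, A, B. The switching sets are X_i = P_i ∪ Q_i and Y = A ∪ B; no edges join P to Q or A to B. Each
X_i has two halves of m + 6 vertices, and an attached vertex of Y is joined to exactly one half, so
switching just interchanges the halves (`gmSwitch_switchableGraph`).

The halves almost coincide with P_i and Q_i, except that one vertex (i, none) of P_i belongs to the
half containing Q_i; likewise one vertex of A is attached to a half otherwise used by B. For `b =
false` only these exceptions produce edges across P ∪ A | Q ∪ B: (m + 3) + (m + 4) from P to B and m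
+ 5 from Q to A, in total d − 1. For `b = true` the analogous cut is P ∪ B | Q ∪ A, and the
exceptions produce 2(m + 4) + (m + 6) = d + 1 edges. The theorem takes `b = true` as Γ and `b =
false` as Γ'.

No cut is smaller (`le_cut_false`, `le_cut_true`): each block has such a large internal minimum
degree that splitting it costs at least 2m + 7 edges, so at most one block needs to be split, and
finitely many colour patterns remain. If all other blocks share a colour, one side of the cut lies
in a single block and is too small to send out fewer than d edges.

Cospectrality is the Godsil–McKay argument: the matrix equal to (2/|X_i|)J − I on each X_i and to
the identity on Y is an involution that conjugates one adjacency matrix to the other. -/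

section Indicator

/-- The indicator of a proposition, as a natural number. -/
noncomputable def ind (p : Prop) : ℕ := if p then 1 else 0

@[simp] theorem ind_true : ind True = 1 := if_pos trivial

@[simp] theorem ind_false : ind False = 0 := if_neg id

theorem ind_of {p : Prop} (h : p) : ind p = 1 := if_pos h

theorem ind_of_not {p : Prop} (h : ¬ p) : ind p = 0 := if_neg h

theorem ind_not_add (p : Prop) : ind (¬ p) + ind p = 1 := by
  by_cases h : p <;> simp [h]

theorem sum_ind_not {α : Type*} [Fintype α] (p : α → Prop) :
    ∑ a, ind (¬ p a) + ∑ a, ind (p a) = Fintype.card α := by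
  simp [← Finset.sum_add_distrib, ind_not_add]

@[simp] theorem sum_ind_eq {α : Type*} [Fintype α] (a : α) : ∑ b, ind (a = b) = 1 := by
  simp [ind]

@[simp] theorem sum_ind_eq' {α : Type*} [Fintype α] (a : α) : ∑ b, ind (b = a) = 1 := by
  simp [ind]

theorem sum_ind_ne {α : Type*} [Fintype α] (a : α) :
    ∑ b, ind (a ≠ b) + 1 = Fintype.card α := by
  rw [← sum_ind_not (fun b => a = b), sum_ind_eq]

theorem card_eq_sum_ind {V : Type*} [Fintype V] (S : Finset V) : S.card = ∑ v, ind (v ∈ S) := by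
  have h : S = Finset.univ.filter fun v => v ∈ S := by
    ext w
    simp
  conv_lhs => rw [h, Finset.card_filter]
  exact Finset.sum_congr rfl fun w _ => by unfold ind; congr

theorem nbrCount_eq_sum_ind {V : Type*} [Fintype V] (G : SimpleGraph V) (v : V) (S : Finset V) :
    nbrCount G v S = ∑ w, ind (w ∈ S ∧ G.Adj v w) := by
  have h : (S.filter fun w => G.Adj v w) = Finset.univ.filter fun w => w ∈ S ∧ G.Adj v w := by
    ext w
    simp
  rw [nbrCount, h, Finset.card_filter]
  exact Finset.sum_congr rfl fun w _ => by unfold ind; congr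

end Indicator

/-! ### Edge cuts as two-colourings. -/

section EdgeConnectivity

set_option linter.unusedSectionVars false

variable {V : Type*} [Fintype V]

/-- The indicator of an edge `uv` whose ends get different colours. -/
noncomputable def sepInd (G : SimpleGraph V) (s : V → Bool) (u v : V) : ℕ :=
  ind (G.Adj u v ∧ s u ≠ s v)

theorem sepInd_comm (G : SimpleGraph V) (s : V → Bool) (u v : V) :
    sepInd G s u v = sepInd G s v u := by
  unfold sepInd
  simp only [G.adj_comm u v, ne_comm (a := s u)]

/-- The edges with differently coloured ends, directed from `true` to `false`. -/
noncomputable def cutPairs (G : SimpleGraph V) (s : V → Bool) : Finset (V × V) :=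
  Finset.univ.filter fun p => G.Adj p.1 p.2 ∧ s p.1 = true ∧ s p.2 = false

/-- The double sum runs over ordered pairs and meets each cut edge twice; this is the source of the
factors 2 in all later bounds. -/
theorem sum_sepInd (G : SimpleGraph V) (s : V → Bool) :
    ∑ u, ∑ v, sepInd G s u v = 2 * (cutPairs G s).card := by
  have h1 : (cutPairs G s).card
      = ∑ u, ∑ v, if G.Adj u v ∧ s u = true ∧ s v = false then 1 else 0 := by
    rw [cutPairs, Finset.card_filter, Fintype.sum_prod_type]
  have h2 : (cutPairs G s).card
      = ∑ u, ∑ v, if G.Adj u v ∧ s u = false ∧ s v = true then 1 else 0 := by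
    rw [h1, Finset.sum_comm]
    refine Finset.sum_congr rfl fun u _ => Finset.sum_congr rfl fun v _ => ?_
    simp only [G.adj_comm v u, and_comm (a := s v = true)]
  rw [two_mul]
  nth_rewrite 1 [h1]
  rw [h2, ← Finset.sum_add_distrib]
  refine Finset.sum_congr rfl fun u _ => ?_
  rw [← Finset.sum_add_distrib]
  refine Finset.sum_congr rfl fun v _ => ?_
  unfold sepInd ind
  cases s u <;> cases s v <;> simp

theorem injOn_mk_cutPairs (G : SimpleGraph V) (s : V → Bool) :
    Set.InjOn (fun p : V × V => s(p.1, p.2)) (cutPairs G s : Set (V × V)) := by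
  rintro ⟨a, b⟩ h1 ⟨c, d⟩ h2 h
  simp only [cutPairs, Finset.coe_filter, Finset.mem_univ, true_and, Set.mem_ofPred_eq] at h1 h2
  rcases Sym2.eq_iff.1 h with ⟨rfl, rfl⟩ | ⟨rfl, rfl⟩
  · rfl
  · simp [h1.2.1] at h2

/-- A colouring criterion for edge-connectivity. -/
theorem isEdgeConnectivity_of_colouring {G : SimpleGraph V} {n : ℕ}
    (hle : ∀ s : V → Bool, (∃ u, s u = true) → (∃ v, s v = false) →
      2 * n ≤ ∑ u, ∑ v, sepInd G s u v)
    (hex : ∃ s : V → Bool, (∃ u, s u = true) ∧ (∃ v, s v = false) ∧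
      ∑ u, ∑ v, sepInd G s u v = 2 * n) : IsEdgeConnectivity G n := by
  constructor
  · obtain ⟨s, ⟨u, hu⟩, ⟨v, hv⟩, hs⟩ := hex
    rw [sum_sepInd] at hs
    refine ⟨(cutPairs G s).image fun p => s(p.1, p.2), ?_, ?_, ?_⟩
    · intro e he
      simp only [Finset.coe_image, Set.mem_image, Finset.mem_coe] at he
      obtain ⟨p, hp, rfl⟩ := he
      exact (Finset.mem_filter.1 hp).2.1
    · rw [Finset.card_image_of_injOn (injOn_mk_cutPairs G s)]
      omega
    · intro hpre
      obtain ⟨w⟩ := hpre u v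
      have key : ∀ a b : V, (G.deleteEdges
          (((cutPairs G s).image fun p => s(p.1, p.2) : Finset (Sym2 V)) : Set (Sym2 V))).Walk a b →
          s a = true → s b = true := by
        intro a b w
        induction w with
        | nil => exact id
        | @cons a c b hac _ ih =>
          intro ha
          apply ih
          by_contra hc
          rw [SimpleGraph.deleteEdges_adj] at hac
          refine hac.2 ?_
          simp only [Finset.coe_image, Set.mem_image, Finset.mem_coe]
          exact ⟨(a, c), Finset.mem_filter.2 ⟨Finset.mem_univ _, hac.1, ha, by simpa using hc⟩, rfl⟩
      have := key u v w hu
      simp [hv] at this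
  · rintro c ⟨F, -, rfl, hF⟩
    simp only [SimpleGraph.Preconnected, not_forall] at hF
    obtain ⟨u, v, huv⟩ := hF
    set H := G.deleteEdges (F : Set (Sym2 V)) with hH
    -- Colour by reachability from `u` after the deletion: every edge of this cut must have been
    -- deleted.
    have h := hle (fun w => decide (H.Reachable u w)) ⟨u, by simp⟩ ⟨v, by simpa using huv⟩
    rw [sum_sepInd] at h
    have h2 : (cutPairs G fun w => decide (H.Reachable u w)).card ≤ F.card := by
      refine Finset.card_le_card_of_injOn (fun p => s(p.1, p.2)) ?_ (injOn_mk_cutPairs G _)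
      rintro ⟨a, b⟩ hab
      simp only [cutPairs, Finset.coe_filter, Finset.mem_univ, true_and, Set.mem_ofPred_eq,
        decide_eq_true_eq, decide_eq_false_iff_not] at hab
      by_contra hF
      refine hab.2.2 (hab.2.1.trans (SimpleGraph.Adj.reachable ?_))
      rw [hH, SimpleGraph.deleteEdges_adj]
      exact ⟨hab.1, by simpa using hF⟩
    omega

/-- A set of at most `δ` vertices, each with at least `δ` neighbours in a finset `C`
containing the set, sends at least `δ` edges to the rest of `C`. -/
theorem le_sum_sepInd_of_card_le {G : SimpleGraph V} {s : V → Bool} {δ : ℕ} {C : Finset V}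
    (hdeg : ∀ u ∈ C, δ ≤ nbrCount G u C) (c : Bool)
    (hne : (C.filter fun u => s u = c).Nonempty)
    (hcard : (C.filter fun u => s u = c).card ≤ δ) :
    2 * δ ≤ ∑ u ∈ C, ∑ v ∈ C, sepInd G s u v := by
  set T := C.filter fun u => s u = c with hT
  set T' := C.filter fun u => ¬ s u = c with hT'
  -- A vertex of `T` has at most |T| − 1 neighbours inside `T`.
  have hout : ∀ u ∈ T, δ + 1 - T.card ≤ ∑ v ∈ T', sepInd G s u v := by
    intro u hu
    have hu' := Finset.mem_filter.1 hu
    have h1 := hdeg u hu'.1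
    have h2 : nbrCount G u C = nbrCount G u T + nbrCount G u T' := by
      simp only [nbrCount, hT, hT']
      rw [Finset.filter_filter, Finset.filter_filter, ← Finset.card_union_of_disjoint]
      · congr 1
        ext v
        simp only [Finset.mem_filter, Finset.mem_union]
        tauto
      · rw [Finset.disjoint_filter]
        tauto
    have h3 : nbrCount G u T + 1 ≤ T.card := by
      have : (T.filter fun w => G.Adj u w) ⊂ T :=
        Finset.filter_ssubset.2 ⟨u, hu, G.irrefl⟩
      exact Finset.card_lt_card this
    have h4 : ∑ v ∈ T', sepInd G s u v = nbrCount G u T' := by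
      rw [nbrCount, Finset.card_filter]
      refine Finset.sum_congr rfl fun v hv => ?_
      have hv' := (Finset.mem_filter.1 hv).2
      unfold sepInd ind
      rw [hu'.2]
      simp [Ne.symm hv']
    omega
  have h1 : T.card * (δ + 1 - T.card) ≤ ∑ u ∈ T, ∑ v ∈ T', sepInd G s u v := by
    have := Finset.card_nsmul_le_sum T _ _ hout
    simpa using this
  have h2 : ∑ u ∈ T', ∑ v ∈ T, sepInd G s u v = ∑ u ∈ T, ∑ v ∈ T', sepInd G s u v := by
    rw [Finset.sum_comm]
    exact Finset.sum_congr rfl fun u _ => Finset.sum_congr rfl fun v _ => sepInd_comm G s v u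
  have h3 : ∑ u ∈ T, ∑ v ∈ T', sepInd G s u v + ∑ u ∈ T', ∑ v ∈ T, sepInd G s u v
      ≤ ∑ u ∈ C, ∑ v ∈ C, sepInd G s u v := by
    rw [← Finset.sum_filter_add_sum_filter_not C (fun u => s u = c)]
    gcongr
    · exact Finset.filter_subset _ _
    · exact Finset.filter_subset _ _
  -- With |T| = 1 + a and δ = |T| + b, the product exceeds δ by ab.
  have h4 : δ ≤ T.card * (δ + 1 - T.card) := by
    have h5 : 1 ≤ T.card := hne.card_pos
    obtain ⟨a, ha⟩ := Nat.exists_eq_add_of_le h5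
    obtain ⟨b, hb⟩ := Nat.exists_eq_add_of_le hcard
    rw [show δ + 1 - T.card = b + 1 by omega, hb, ha]
    nlinarith [Nat.zero_le (a * b)]
  omega

/-- Splitting a vertex set `C` of large minimum degree `δ` costs at least `δ` edges. -/
theorem le_sum_sepInd_of_split {G : SimpleGraph V} {s : V → Bool} {δ : ℕ} {C : Finset V}
    (hdeg : ∀ u ∈ C, δ ≤ nbrCount G u C) (hC : C.card < 2 * δ + 2)
    {u v : V} (hu : u ∈ C) (hv : v ∈ C) (huv : s u ≠ s v) :
    2 * δ ≤ ∑ u ∈ C, ∑ v ∈ C, sepInd G s u v := by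
  have hsplit := Finset.card_filter_add_card_filter_not (s := C) (fun w => s w = s u)
  have hnot : (C.filter fun w => ¬ s w = s u) = C.filter fun w => s w = s v := by
    refine Finset.filter_congr fun w _ => ?_
    revert huv
    cases s w <;> cases s u <;> cases s v <;> simp
  rw [hnot] at hsplit
  -- Among at most 2δ + 1 vertices, one of the two colours occurs at most δ times.
  rcases le_or_gt (C.filter fun w => s w = s u).card δ with h | h
  · exact le_sum_sepInd_of_card_le hdeg (s u) ⟨u, by simp [hu]⟩ h
  · exact le_sum_sepInd_of_card_le hdeg (s v) ⟨v, by simp [hv]⟩ (by omega)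

end EdgeConnectivity

/-! ### Regular graphs of odd order. -/

section RegularGraphs

/-- In a cyclic group of odd order no nonzero element is its own inverse, so a symmetric set grows
by pairs x, −x. -/
theorem exists_symmetric_finset {N : ℕ} [NeZero N] (hN : Odd N) (j : ℕ) (hj : 2 * j < N) :
    ∃ D : Finset (ZMod N), D.card = 2 * j ∧ 0 ∉ D ∧ ∀ x ∈ D, -x ∈ D := by
  induction j with
  | zero => exact ⟨∅, by simp⟩
  | succ j ih =>
    obtain ⟨D, hD, h0, hneg⟩ := ih (by omega)
    have : ∃ x, x ∉ insert 0 D := by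
      by_contra! h
      have h1 : insert 0 D = Finset.univ := Finset.eq_univ_of_forall h
      have h2 := congrArg Finset.card h1
      rw [Finset.card_insert_of_notMem h0, hD, Finset.card_univ, ZMod.card] at h2
      omega
    obtain ⟨x, hx⟩ := this
    simp only [Finset.mem_insert, not_or] at hx
    have hxx : x ≠ -x := ZMod.ne_neg_self hN hx.1
    have hnx : -x ∉ D := fun h => hx.2 (by simpa using hneg _ h)
    refine ⟨insert x (insert (-x) D), ?_, ?_, ?_⟩
    · rw [Finset.card_insert_of_notMem (by simp [hxx, hx.2]), Finset.card_insert_of_notMem hnx, hD]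
      ring
    · simp only [Finset.mem_insert, not_or]
      exact ⟨Ne.symm hx.1, fun h => hx.1 (by simpa using h.symm), h0⟩
    · intro y hy
      simp only [Finset.mem_insert] at hy ⊢
      rcases hy with rfl | rfl | hy
      · simp
      · simp
      · exact Or.inr (Or.inr (hneg y hy))

/-- On a set of odd size there is a regular graph of every even degree. -/
theorem exists_regular_graph {α : Type*} [Fintype α] (hα : Odd (Fintype.card α)) {j : ℕ}
    (hj : 2 * j < Fintype.card α) :
    ∃ G : SimpleGraph α, ∀ a, ∑ b, ind (G.Adj a b) = 2 * j := by
  have : NeZero (Fintype.card α) := ⟨by omega⟩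
  obtain ⟨D, hD, h0, hneg⟩ := exists_symmetric_finset hα j hj
  let f : α ≃ ZMod (Fintype.card α) := Fintype.equivOfCardEq (by rw [ZMod.card])
  -- The Cayley graph with connection set `D`, carried over by `f`.
  refine ⟨⟨fun a b => f b - f a ∈ D, ⟨fun a b h => by simpa using hneg _ h⟩,
    ⟨fun a h => h0 (by simpa using h)⟩⟩, fun a => ?_⟩
  rw [← hD]
  unfold ind
  rw [← Equiv.sum_comp ((Equiv.addRight (f a)).trans f.symm)]
  simp

end RegularGraphs

/-! ### Godsil–McKay switching preserves the spectrum. -/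

section Cospectral

theorem gmSwitch_adj {V : Type*} {m : ℕ} (G : SimpleGraph V) (X : Fin m → Finset V)
    (u v : V) :
    (gmSwitch G X).Adj u v ↔ Xor (G.Adj u v) (GMSwitched G X u v ∨ GMSwitched G X v u) :=
  Iff.rfl

set_option linter.unusedSectionVars false

variable {V : Type*} [Fintype V] {m : ℕ}

theorem nbrCount_eq_sum (G : SimpleGraph V) (v : V) (S : Finset V) :
    (nbrCount G v S : ℂ) = ∑ w ∈ S, if G.Adj v w then (1 : ℂ) else 0 := by
  simp [nbrCount]

/-- The matrix that conjugates the adjacency matrix of a graph to that of the switched graph. -/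
noncomputable def gmMatrix (X : Fin m → Finset V) : Matrix V V ℂ :=
  fun u v => (∑ i, if u ∈ X i ∧ v ∈ X i then (2 : ℂ) / (X i).card else 0) +
    (if u = v then if ∃ i, u ∈ X i then -1 else 1 else 0)

variable {G : SimpleGraph V} {X : Fin m → Finset V}

theorem IsGMPartition.index_unique (h : IsGMPartition G X) {i j : Fin m} {u : V} (hi : u ∈ X i)
    (hj : u ∈ X j) : i = j := by
  by_contra hij
  exact Finset.disjoint_left.1 (h.disjoint i j hij) hi hj

theorem IsGMPartition.sum_gmMatrix_of_mem (h : IsGMPartition G X) {i : Fin m} {u : V}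
    (hu : u ∈ X i) (f : V → ℂ) :
    ∑ w, gmMatrix X u w * f w = 2 / (X i).card * (∑ w ∈ X i, f w) - f u := by
  have h1 : ∀ w, gmMatrix X u w = (if w ∈ X i then (2 : ℂ) / (X i).card else 0) +
      (if u = w then -1 else 0) := by
    intro w
    unfold gmMatrix
    rw [if_pos (⟨i, hu⟩ : ∃ i, u ∈ X i), Finset.sum_eq_single i]
    · simp [hu]
    · intro j _ hj
      rw [if_neg]
      exact fun h' => hj (h.index_unique h'.1 hu)
    · simp
  simp_rw [h1, add_mul, Finset.sum_add_distrib, ite_mul, zero_mul]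
  rw [← Finset.sum_filter]
  simp [Finset.mul_sum, sub_eq_add_neg]

theorem IsGMPartition.sum_gmMatrix_of_notMem {u : V} (hu : ∀ i, u ∉ X i) (f : V → ℂ) :
    ∑ w, gmMatrix X u w * f w = f u := by
  simp [gmMatrix, hu]

theorem gmMatrix_symm (X : Fin m → Finset V) (u v : V) : gmMatrix X u v = gmMatrix X v u := by
  unfold gmMatrix
  congr 1
  · simp_rw [and_comm]
  · by_cases h : u = v
    · subst h; rfl
    · rw [if_neg h, if_neg (Ne.symm h)]

/-- On a block of size n, (2/n J − I)² = I because J² = nJ. -/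
theorem IsGMPartition.gmMatrix_mul_self (h : IsGMPartition G X) :
    gmMatrix X * gmMatrix X = 1 := by
  ext u v
  rw [Matrix.mul_apply, Matrix.one_apply]
  by_cases hu : ∃ i, u ∈ X i
  · obtain ⟨i, hi⟩ := hu
    rw [h.sum_gmMatrix_of_mem hi fun w => gmMatrix X w v]
    have hc : ((X i).card : ℂ) ≠ 0 := by
      exact_mod_cast (h.nonempty i).card_pos.ne'
    have h1 : ∑ w ∈ X i, gmMatrix X w v = ∑ w, gmMatrix X v w * if w ∈ X i then 1 else 0 := by
      simp only [mul_ite, mul_one, mul_zero]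
      rw [← Finset.sum_filter]
      simp [gmMatrix_symm X v]
    rw [h1]
    by_cases hv : ∃ j, v ∈ X j
    · obtain ⟨j, hj⟩ := hv
      rw [h.sum_gmMatrix_of_mem hj]
      by_cases hij : i = j
      · subst hij
        have : ∑ w ∈ X i, (if w ∈ X i then (1 : ℂ) else 0) = (X i).card := by simp
        rw [this, if_pos hj]
        unfold gmMatrix
        rw [if_pos (⟨i, hi⟩ : ∃ i, u ∈ X i), Finset.sum_eq_single i]
        · by_cases huv : u = v
          · simp [huv, hj]; field_simp; norm_num
          · simp [huv, hi, hj]; field_simp; norm_num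
        · intro l _ hl
          rw [if_neg]
          exact fun h' => hl (h.index_unique h'.1 hi)
        · simp
      · have hvi : v ∉ X i := fun h' => hij (h.index_unique h' hj)
        have huv : u ≠ v := fun h' => hvi (h' ▸ hi)
        have h2 : ∑ w ∈ X j, (if w ∈ X i then (1 : ℂ) else 0) = 0 := by
          refine Finset.sum_eq_zero fun w hw => if_neg fun h' => hij (h.index_unique h' hw)
        rw [h2, if_neg hvi, if_neg huv]
        unfold gmMatrix
        rw [if_neg huv, Finset.sum_eq_zero]
        · simp
        · intro l _
          rw [if_neg]
          exact fun h' => hij ((h.index_unique hi h'.1).trans (h.index_unique h'.2 hj))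
    · push Not at hv
      rw [IsGMPartition.sum_gmMatrix_of_notMem hv, if_neg (hv i),
        gmMatrix_symm]
      have huv : u ≠ v := fun h' => hv i (h' ▸ hi)
      simp [gmMatrix, hv, huv, Ne.symm huv]
  · push Not at hu
    rw [IsGMPartition.sum_gmMatrix_of_notMem hu fun w => gmMatrix X w v]
    simp [gmMatrix, hu]

/-- Double counting of the edges between X_i and X_j. -/
theorem IsGMPartition.sum_adj_comm (h : IsGMPartition G X) {i j : Fin m} {u v : V}
    (hu : u ∈ X i) (hv : v ∈ X j) :
    (2 : ℂ) / (X i).card * nbrCount G v (X i) = 2 / (X j).card * nbrCount G u (X j) := by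
  have hi : ((X i).card : ℂ) ≠ 0 := by exact_mod_cast (h.nonempty i).card_pos.ne'
  have hj : ((X j).card : ℂ) ≠ 0 := by exact_mod_cast (h.nonempty j).card_pos.ne'
  have h1 : ∑ x ∈ X i, (nbrCount G x (X j) : ℂ) = (X i).card * nbrCount G u (X j) := by
    rw [Finset.sum_congr rfl fun x hx => by rw [h.equitable i j x hx u hu]]
    simp
  have h2 : ∑ x ∈ X j, (nbrCount G x (X i) : ℂ) = (X j).card * nbrCount G v (X i) := by
    rw [Finset.sum_congr rfl fun x hx => by rw [h.equitable j i x hx v hv]]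
    simp
  have h3 : ∑ x ∈ X i, (nbrCount G x (X j) : ℂ) = ∑ x ∈ X j, (nbrCount G x (X i) : ℂ) := by
    simp_rw [nbrCount_eq_sum]
    rw [Finset.sum_comm]
    simp_rw [G.adj_comm]
  rw [h1, h2] at h3
  field_simp
  linear_combination -h3

/-- The quotient 2 · `nbrCount` / |X_i| is 0, 1 or 2. In the middle case the formula complements the
adjacency; in the extreme cases the adjacency is constantly 0 or 1 and the formula returns it
unchanged. -/
theorem IsGMPartition.adj_gmSwitch_of_notMem (h : IsGMPartition G X) {i : Fin m} {u v : V}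
    (hu : u ∈ X i) (hv : ∀ j, v ∉ X j) :
    (if (gmSwitch G X).Adj u v then (1 : ℂ) else 0) =
      2 / (X i).card * nbrCount G v (X i) - if G.Adj u v then 1 else 0 := by
  have hi : ((X i).card : ℂ) ≠ 0 := by exact_mod_cast (h.nonempty i).card_pos.ne'
  have h1 : GMSwitched G X u v ↔ 2 * nbrCount G v (X i) = (X i).card := by
    constructor
    · rintro ⟨j, hj, -, h'⟩
      rwa [h.index_unique hu hj]
    · exact fun h' => ⟨i, hu, hv, h'⟩
  have h2 : ¬ GMSwitched G X v u := by
    rintro ⟨j, hj, -⟩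
    exact hv j hj
  rw [gmSwitch_adj, h1]
  simp only [h2, or_false]
  rcases h.half i v hv with h0 | h0 | h0
  · have h3 : ¬ G.Adj u v := by
      intro h'
      rw [nbrCount, Finset.card_eq_zero] at h0
      have : u ∈ (X i).filter fun w => G.Adj v w := Finset.mem_filter.2 ⟨hu, h'.symm⟩
      rw [h0] at this
      simp at this
    have h4 := (h.nonempty i).card_pos.ne
    simp [h0, h3, Xor, h4]
  · have h3 : (nbrCount G v (X i) : ℂ) = (X i).card / 2 := by
      rw [← h0]; push_cast; ring
    rw [h3]
    by_cases h4 : G.Adj u v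
    · simp [h4, h0, Xor]
      field_simp
      norm_num
    · simp [h4, h0, Xor]
      field_simp
  · have h3 : G.Adj u v := by
      have := Finset.eq_of_subset_of_card_le (Finset.filter_subset _ _) h0.ge
      rw [← this] at hu
      exact (Finset.mem_filter.1 hu).2.symm
    have h4 := (h.nonempty i).card_pos.ne'
    have h5 : ¬ 2 * (X i).card = (X i).card := by omega
    simp [h0, h3, Xor, h4]
    field_simp
    norm_num

theorem IsGMPartition.sum_adj_gmSwitch (h : IsGMPartition G X) {i : Fin m} {v : V}
    (hv : ∀ j, v ∉ X j) :
    ∑ w ∈ X i, (if (gmSwitch G X).Adj w v then (1 : ℂ) else 0) = nbrCount G v (X i) := by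
  have hi : ((X i).card : ℂ) ≠ 0 := by exact_mod_cast (h.nonempty i).card_pos.ne'
  rw [Finset.sum_congr rfl fun w hw => h.adj_gmSwitch_of_notMem hw hv, Finset.sum_sub_distrib,
    nbrCount_eq_sum]
  simp_rw [G.adj_comm v]
  simp
  field_simp
  ring

theorem IsGMPartition.adj_gmSwitch_of_mem {u v : V}
    (huv : (∃ i, u ∈ X i) ↔ ∃ j, v ∈ X j) :
    (gmSwitch G X).Adj u v ↔ G.Adj u v := by
  have h1 : ¬ GMSwitched G X u v := by
    rintro ⟨i, hi, hv, -⟩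
    obtain ⟨j, hj⟩ := huv.1 ⟨i, hi⟩
    exact hv j hj
  have h2 : ¬ GMSwitched G X v u := by
    rintro ⟨i, hi, hv, -⟩
    obtain ⟨j, hj⟩ := huv.2 ⟨i, hi⟩
    exact hv j hj
  rw [gmSwitch_adj]
  simp [h1, h2, Xor]

/-- Compared blockwise: between switching sets the J-terms agree by `sum_adj_comm`; between a
switching set and Y the identity is `adj_gmSwitch_of_notMem`, together with the fact that
complementing a half keeps the neighbour count; on Y both sides are the adjacency matrix of G. -/
theorem IsGMPartition.gmMatrix_mul_adjMatrix (h : IsGMPartition G X) :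
    gmMatrix X * G.adjMatrix ℂ = (gmSwitch G X).adjMatrix ℂ * gmMatrix X := by
  ext u v
  rw [Matrix.mul_apply, Matrix.mul_apply]
  simp_rw [mul_comm ((gmSwitch G X).adjMatrix ℂ u _), gmMatrix_symm X _ v]
  simp only [SimpleGraph.adjMatrix_apply]
  by_cases hu : ∃ i, u ∈ X i <;> by_cases hv : ∃ j, v ∈ X j
  · obtain ⟨i, hi⟩ := hu
    obtain ⟨j, hj⟩ := hv
    rw [h.sum_gmMatrix_of_mem hi fun w => if G.Adj w v then (1 : ℂ) else 0,
      h.sum_gmMatrix_of_mem hj]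
    have h1 : ∀ w ∈ X j, (if (gmSwitch G X).Adj u w then (1 : ℂ) else 0)
        = if G.Adj u w then 1 else 0 := fun w hw => by
      rw [IsGMPartition.adj_gmSwitch_of_mem (iff_of_true ⟨i, hi⟩ ⟨j, hw⟩)]
    rw [Finset.sum_congr rfl h1, h1 v hj, ← nbrCount_eq_sum]
    simp_rw [G.adj_comm _ v]
    rw [← nbrCount_eq_sum, h.sum_adj_comm hi hj]
  · obtain ⟨i, hi⟩ := hu
    push Not at hv
    rw [h.sum_gmMatrix_of_mem hi fun w => if G.Adj w v then (1 : ℂ) else 0,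
      IsGMPartition.sum_gmMatrix_of_notMem hv, h.adj_gmSwitch_of_notMem hi hv, nbrCount_eq_sum]
    simp_rw [G.adj_comm v]
  · obtain ⟨j, hj⟩ := hv
    push Not at hu
    rw [IsGMPartition.sum_gmMatrix_of_notMem hu fun w => if G.Adj w v then (1 : ℂ) else 0,
      h.sum_gmMatrix_of_mem hj]
    simp_rw [(gmSwitch G X).adj_comm u]
    rw [h.sum_adj_gmSwitch hu, h.adj_gmSwitch_of_notMem hj hu]
    simp_rw [G.adj_comm v]
    ring
  · have huv := IsGMPartition.adj_gmSwitch_of_mem (G := G) (iff_of_false hu hv)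
    push Not at hu hv
    rw [IsGMPartition.sum_gmMatrix_of_notMem hu fun w => if G.Adj w v then (1 : ℂ) else 0,
      IsGMPartition.sum_gmMatrix_of_notMem hv]
    simp only [huv]

/-- Godsil–McKay switching preserves the spectrum. -/
theorem IsGMPartition.adjSpectrum_gmSwitch (h : IsGMPartition G X) :
    adjSpectrum G = adjSpectrum (gmSwitch G X) := by
  let M : (Matrix V V ℂ)ˣ := ⟨gmMatrix X, gmMatrix X, h.gmMatrix_mul_self, h.gmMatrix_mul_self⟩
  have h1 : (gmSwitch G X).adjMatrix ℂ = M.val * G.adjMatrix ℂ * M⁻¹.val := by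
    change _ = gmMatrix X * G.adjMatrix ℂ * gmMatrix X
    rw [h.gmMatrix_mul_adjMatrix, mul_assoc, h.gmMatrix_mul_self, mul_one]
  unfold adjSpectrum
  rw [h1, Matrix.coe_units_inv, ← Matrix.charpoly_units_conj M]

end Cospectral

/-! ### The graph, its switching sets and its regularity. -/

section Construction

/-- The join of a graph on `α` with the complete graph on `β`. -/
def joinComplete {α : Type*} (H : SimpleGraph α) (β : Type*) : SimpleGraph (α ⊕ β) where
  Adj
    | .inl a, .inl b => H.Adj a b
    | .inl _, .inr _ => True
    | .inr _, .inl _ => True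
    | .inr a, .inr b => a ≠ b
  symm := ⟨by
    rintro (a | a) (b | b) h
    · exact SimpleGraph.Adj.symm (G := H) h
    · trivial
    · trivial
    · exact Ne.symm h⟩
  loopless := ⟨by
    rintro (a | a) h
    · exact H.irrefl h
    · exact h rfl⟩

/-- The part of the switching sets that is dense but not complete; the pairs `(i, none)` are
the vertices of this part that have their outside neighbours on the other side of the cut. -/
abbrev PVert (m : ℕ) := Fin 2 × Option (Fin (m + 6))

/-- The part of the switching sets that forms a clique. -/
abbrev QVert (m : ℕ) := Fin 2 × Fin (m + 5)

/-- The left summand is attached to the switching sets, and `none` is its exceptional vertex; the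
right summand has no neighbours outside the block. -/
abbrev AVert (m : ℕ) := Option (Fin 2 × Fin (m + 4)) ⊕ Fin (m + 5)

/-- The attached vertices are split as m + 3 and m + 4 over the two switching sets. The exceptional
vertex of A makes up the deficit, so that every half has m + 4 outside neighbours. Both A and B have
d + 1 = 3m + 14 vertices. -/
abbrev BVert (m : ℕ) := (Fin (m + 3) ⊕ Fin (m + 4)) ⊕ Fin (m + 7)

abbrev Vert (m : ℕ) := (PVert m ⊕ QVert m) ⊕ (AVert m ⊕ BVert m)

variable {m : ℕ}

/-- The index of the switching set of a vertex. -/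
def switchIndex : PVert m ⊕ QVert m → Fin 2
  | .inl p => p.1
  | .inr q => q.1

/-- The two halves of each switching set. -/
def inFirstHalf : PVert m ⊕ QVert m → Bool
  | .inl (_, some _) => true
  | .inl (_, none) => false
  | .inr _ => false

/-- The switching set and its half to which an outside vertex is joined. -/
def joinedHalf : AVert m ⊕ BVert m → Option (Fin 2 × Bool)
  | .inl (.inl (some (i, _))) => some (i, true)
  | .inl (.inl none) => some (0, false)
  | .inl (.inr _) => none
  | .inr (.inl (.inl _)) => some (0, false)
  | .inr (.inl (.inr _)) => some (1, false)
  | .inr (.inr _) => none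

/-- The graph induced on the union of the switching sets. -/
def switchGraph (C : SimpleGraph (Option (Fin (m + 6)))) : SimpleGraph (PVert m ⊕ QVert m) where
  Adj
    | .inl p, .inl q => p ≠ q ∧ ¬ C.Adj p.2 q.2
    | .inl _, .inr _ => False
    | .inr _, .inl _ => False
    | .inr p, .inr q => p ≠ q
  symm := ⟨by
    rintro (p | p) (q | q) h
    · exact ⟨h.1.symm, fun h' => h.2 h'.symm⟩
    · exact h
    · exact h
    · exact Ne.symm h⟩
  loopless := ⟨by
    rintro (p | p) h
    · exact h.1 rfl
    · exact h rfl⟩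

/-- The graph on the disjoint union of two sets of vertices, where each vertex of the second is
joined to one of the halves of one of the switching sets; `b` tells whether the halves are
interchanged. -/
def switchableGraph (C : SimpleGraph (Option (Fin (m + 6))))
    (HA : SimpleGraph (Option (Fin 2 × Fin (m + 4)))) (HB : SimpleGraph (Fin (m + 3) ⊕ Fin (m + 4)))
    (b : Bool) : SimpleGraph (Vert m) where
  Adj
    | .inl x, .inl y => (switchGraph C).Adj x y
    | .inl x, .inr y => joinedHalf y = some (switchIndex x, xor b (inFirstHalf x))
    | .inr x, .inl y => joinedHalf x = some (switchIndex y, xor b (inFirstHalf y))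
    | .inr (.inl x), .inr (.inl y) => (joinComplete HA _).Adj x y
    | .inr (.inr x), .inr (.inr y) => (joinComplete HB _).Adj x y
    | .inr (.inl _), .inr (.inr _) => False
    | .inr (.inr _), .inr (.inl _) => False
  symm := ⟨by
    rintro (x | x | x) (y | y | y) h
    · exact SimpleGraph.Adj.symm (G := switchGraph C) h
    · exact h
    · exact h
    · exact h
    · exact SimpleGraph.Adj.symm (G := joinComplete HA _) h
    · exact h
    · exact h
    · exact h
    · exact SimpleGraph.Adj.symm (G := joinComplete HB _) h⟩
  loopless := ⟨by
    rintro (x | x | x) h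
    · exact (switchGraph C).irrefl h
    · exact (joinComplete HA _).irrefl h
    · exact (joinComplete HB _).irrefl h⟩

/-- The switching sets. -/
noncomputable def switchSets (m : ℕ) (i : Fin 2) : Finset (Vert m) :=
  Finset.univ.filter fun v => Sum.elim (fun x => switchIndex x = i) (fun _ => False) v

theorem inl_mem_switchSets {i : Fin 2} {x : PVert m ⊕ QVert m} :
    (.inl x : Vert m) ∈ switchSets m i ↔ switchIndex x = i := by
  simp [switchSets]

theorem inr_notMem_switchSets {i : Fin 2} {y : AVert m ⊕ BVert m} :
    (.inr y : Vert m) ∉ switchSets m i := by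
  simp [switchSets]

@[simp] theorem switchIndex_inl (p : PVert m) : switchIndex (.inl p) = p.1 := rfl

@[simp] theorem switchIndex_inr (q : QVert m) : switchIndex (.inr q) = q.1 := rfl

@[simp] theorem inFirstHalf_inl_some (i : Fin 2) (z : Fin (m + 6)) :
    inFirstHalf (.inl (i, some z) : PVert m ⊕ QVert m) = true := rfl

@[simp] theorem inFirstHalf_inl_none (i : Fin 2) :
    inFirstHalf (.inl (i, none) : PVert m ⊕ QVert m) = false := rfl

@[simp] theorem inFirstHalf_inr (q : QVert m) : inFirstHalf (.inr q) = false := rfl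

@[simp] theorem joinedHalf_some (a : Fin 2 × Fin (m + 4)) :
    joinedHalf (.inl (.inl (some a)) : AVert m ⊕ BVert m) = some (a.1, true) := rfl

@[simp] theorem joinedHalf_none :
    joinedHalf (.inl (.inl none) : AVert m ⊕ BVert m) = some (0, false) := rfl

@[simp] theorem joinedHalf_inl_inr (a : Fin (m + 5)) :
    joinedHalf (.inl (.inr a) : AVert m ⊕ BVert m) = none := rfl

@[simp] theorem joinedHalf_inr_inl_inl (a : Fin (m + 3)) :
    joinedHalf (.inr (.inl (.inl a)) : AVert m ⊕ BVert m) = some (0, false) := rfl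

@[simp] theorem joinedHalf_inr_inl_inr (a : Fin (m + 4)) :
    joinedHalf (.inr (.inl (.inr a)) : AVert m ⊕ BVert m) = some (1, false) := rfl

@[simp] theorem joinedHalf_inr_inr (a : Fin (m + 7)) :
    joinedHalf (.inr (.inr a) : AVert m ⊕ BVert m) = none := rfl

variable {C : SimpleGraph (Option (Fin (m + 6)))}
  {HA : SimpleGraph (Option (Fin 2 × Fin (m + 4)))} {HB : SimpleGraph (Fin (m + 3) ⊕ Fin (m + 4))}
  {b : Bool}

/-- Each vertex misses its two `C`-neighbours in both layers of m + 7 vertices. The counts are thus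
those of the clique Q with its layers of m + 5, as equitability requires. -/
theorem sum_switchGraph_PVert (hC : ∀ z, ∑ w, ind (C.Adj z w) = 2) (p : PVert m) (j : Fin 2) :
    ∑ w, ind (p ≠ (j, w) ∧ ¬ C.Adj p.2 w) = if p.1 = j then m + 4 else m + 5 := by
  obtain ⟨i, z⟩ := p
  have h1 := sum_ind_not (fun w => C.Adj z w)
  rw [hC z, Fintype.card_option, Fintype.card_fin] at h1
  by_cases hij : i = j
  · subst hij
    have h2 : ∑ w, ind (¬ C.Adj z w) =
        ∑ w, ind ((i, z) ≠ (i, w) ∧ ¬ C.Adj z w) + ∑ w, ind (z = w) := by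
      rw [← Finset.sum_add_distrib]
      refine Finset.sum_congr rfl fun w _ => ?_
      by_cases h : z = w
      · subst h; simp
      · simp [h]
    rw [sum_ind_eq] at h2
    rw [if_pos rfl]
    dsimp only
    omega
  · have h2 : ∀ w, ((i, z) ≠ (j, w) ∧ ¬ C.Adj z w) = ¬ C.Adj z w := fun w => by simp [hij]
    simp only [h2, if_neg hij]
    omega

theorem sum_ne_QVert (q : QVert m) (j : Fin 2) :
    ∑ w, ind (q ≠ (j, w)) = if q.1 = j then m + 4 else m + 5 := by
  obtain ⟨i, z⟩ := q
  have h1 := sum_ind_ne z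
  rw [Fintype.card_fin] at h1
  by_cases hij : i = j
  · subst hij
    simp only [ne_eq, Prod.mk.injEq, true_and, if_true] at *
    omega
  · simp [hij]

theorem sum_switchIndex (f : PVert m ⊕ QVert m → Prop) (j : Fin 2) :
    ∑ x, ind (switchIndex x = j ∧ f x) =
      ∑ z, ind (f (.inl (j, z))) + ∑ z, ind (f (.inr (j, z))) := by
  rw [Fintype.sum_sum_type, Fintype.sum_prod_type, Fintype.sum_prod_type,
    Finset.sum_eq_single j, Finset.sum_eq_single j]
  · simp
  all_goals simp +contextual

theorem sum_switchGraph (hC : ∀ z, ∑ w, ind (C.Adj z w) = 2) (x : PVert m ⊕ QVert m)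
    (j : Fin 2) :
    ∑ y, ind (switchIndex y = j ∧ (switchGraph C).Adj x y) =
      if switchIndex x = j then m + 4 else m + 5 := by
  rw [sum_switchIndex]
  rcases x with p | q
  · have h := sum_switchGraph_PVert hC p j
    simp only [switchGraph, switchIndex_inl, ind_false, Finset.sum_const_zero, add_zero]
    exact h.trans (by congr)
  · have h := sum_ne_QVert q j
    simp only [switchGraph, switchIndex_inr, ind_false, Finset.sum_const_zero, zero_add]
    exact h.trans (by congr)

theorem sum_inFirstHalf (j : Fin 2) (c : Bool) :
    ∑ x : PVert m ⊕ QVert m, ind (switchIndex x = j ∧ c = xor b (inFirstHalf x)) = m + 6 := by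
  rw [sum_switchIndex]
  cases b <;> cases c <;> simp [Fintype.sum_option] <;> ring

theorem sum_joinedHalf (i : Fin 2) (c : Bool) :
    ∑ y : AVert m ⊕ BVert m, ind (joinedHalf y = some (i, c)) = m + 4 := by
  fin_cases i <;> cases c <;>
    simp [Fintype.sum_option, Fintype.sum_prod_type, Fintype.sum_sum_type] <;> ring

theorem sum_joinComplete_inl {α β : Type*} [Fintype α] [Fintype β] (H : SimpleGraph α) (a : α) :
    ∑ v, ind ((joinComplete H β).Adj (.inl a) v) = ∑ b, ind (H.Adj a b) + Fintype.card β := by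
  simp [joinComplete, Fintype.sum_sum_type]

theorem sum_joinComplete_inr {α β : Type*} [Fintype α] [Fintype β] (H : SimpleGraph α) (a : β) :
    ∑ v, ind ((joinComplete H β).Adj (.inr a) v) + 1 = Fintype.card α + Fintype.card β := by
  rw [← sum_ind_ne a, Fintype.sum_sum_type]
  simp [joinComplete, add_assoc]

theorem nbrCount_inl_switchSets (hC : ∀ z, ∑ w, ind (C.Adj z w) = 2)
    (x : PVert m ⊕ QVert m) (j : Fin 2) :
    nbrCount (switchableGraph C HA HB b) (.inl x) (switchSets m j) =
      if switchIndex x = j then m + 4 else m + 5 := by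
  rw [nbrCount_eq_sum_ind, Fintype.sum_sum_type]
  simp only [inl_mem_switchSets, inr_notMem_switchSets, false_and, ind_false,
    Finset.sum_const_zero, add_zero]
  exact sum_switchGraph hC x j

theorem nbrCount_inr_switchSets (y : AVert m ⊕ BVert m) (j : Fin 2) :
    nbrCount (switchableGraph C HA HB b) (.inr y) (switchSets m j) =
      if ∃ c, joinedHalf y = some (j, c) then m + 6 else 0 := by
  rw [nbrCount_eq_sum_ind, Fintype.sum_sum_type]
  simp only [inl_mem_switchSets, inr_notMem_switchSets, false_and, ind_false,
    Finset.sum_const_zero, add_zero]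
  split_ifs with h
  · obtain ⟨c, hc⟩ := h
    refine Eq.trans (Finset.sum_congr rfl fun x _ => ?_) (sum_inFirstHalf (b := b) j c)
    simp only [switchableGraph, hc, Option.some.injEq, Prod.mk.injEq]
    by_cases h : switchIndex x = j <;> simp [h]
  · refine Finset.sum_eq_zero fun x _ => ind_of_not ?_
    rintro ⟨rfl, h'⟩
    exact h ⟨_, h'⟩

theorem card_switchSets (i : Fin 2) : (switchSets m i).card = 2 * (m + 6) := by
  rw [card_eq_sum_ind, Fintype.sum_sum_type]
  simp only [inl_mem_switchSets, inr_notMem_switchSets, ind_false, Finset.sum_const_zero, add_zero]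
  have h1 := sum_switchIndex (m := m) (fun _ => True) i
  simp only [and_true] at h1
  rw [h1]
  simp
  ring

/-- The switching sets satisfy the hypotheses of Godsil–McKay switching. -/
theorem isGMPartition_switchSets (hC : ∀ z, ∑ w, ind (C.Adj z w) = 2) :
    IsGMPartition (switchableGraph C HA HB b) (switchSets m) where
  nonempty i := ⟨.inl (.inl (i, none)), inl_mem_switchSets.2 rfl⟩
  disjoint i j hij := by
    rw [Finset.disjoint_left]
    rintro (x | y) hi hj
    · rw [inl_mem_switchSets] at hi hj
      exact hij (hi.symm.trans hj)
    · exact inr_notMem_switchSets hi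
  equitable i j := by
    rintro (x | y) hx (x' | y') hx'
    · rw [inl_mem_switchSets] at hx hx'
      rw [nbrCount_inl_switchSets hC, nbrCount_inl_switchSets hC, hx, hx']
    · exact (inr_notMem_switchSets hx').elim
    · exact (inr_notMem_switchSets hx).elim
    · exact (inr_notMem_switchSets hx).elim
  half i := by
    rintro (x | y) hy
    · exact (hy _ (inl_mem_switchSets.2 rfl)).elim
    · rw [nbrCount_inr_switchSets, card_switchSets]
      split_ifs <;> simp

theorem exists_half_switchSets (i : Fin 2) : ∃ y : Vert m, (∀ j, y ∉ switchSets m j) ∧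
    2 * nbrCount (switchableGraph C HA HB b) y (switchSets m i) = (switchSets m i).card := by
  refine ⟨.inr (.inl (.inl (some (i, 0)))), fun j => inr_notMem_switchSets, ?_⟩
  rw [nbrCount_inr_switchSets, card_switchSets, if_pos ⟨true, rfl⟩]

theorem gmSwitched_inl_inr (x : PVert m ⊕ QVert m) (y : AVert m ⊕ BVert m) :
    GMSwitched (switchableGraph C HA HB b) (switchSets m) (.inl x) (.inr y) ↔
      ∃ c, joinedHalf y = some (switchIndex x, c) := by
  unfold GMSwitched
  constructor
  · rintro ⟨i, hi, -, h⟩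
    rw [inl_mem_switchSets] at hi
    rw [nbrCount_inr_switchSets, card_switchSets] at h
    rw [hi]
    by_contra h'
    rw [if_neg h'] at h
    omega
  · intro h
    refine ⟨_, inl_mem_switchSets.2 rfl, fun j => inr_notMem_switchSets, ?_⟩
    rw [nbrCount_inr_switchSets, card_switchSets, if_pos h]

theorem not_gmSwitched_inr {G : SimpleGraph (Vert m)} (y : AVert m ⊕ BVert m) (v : Vert m) :
    ¬ GMSwitched G (switchSets m) (.inr y) v := fun ⟨_, h, _⟩ => inr_notMem_switchSets h

theorem not_gmSwitched_inl {G : SimpleGraph (Vert m)} (x : PVert m ⊕ QVert m) (v : Vert m) :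
    ¬ GMSwitched G (switchSets m) v (.inl x) := fun ⟨_, _, h, _⟩ => h _ (inl_mem_switchSets.2 rfl)

/-- Switching interchanges the halves of the switching sets. -/
theorem gmSwitch_switchableGraph :
    gmSwitch (switchableGraph C HA HB b) (switchSets m) = switchableGraph C HA HB (!b) := by
  -- Attached to this half, exclusive or attached to either half, means attached to the other half.
  have key : ∀ (x : PVert m ⊕ QVert m) (y : AVert m ⊕ BVert m),
      Xor (joinedHalf y = some (switchIndex x, xor b (inFirstHalf x)))
        (∃ c, joinedHalf y = some (switchIndex x, c)) ↔
      joinedHalf y = some (switchIndex x, xor (!b) (inFirstHalf x)) := by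
    intro x y
    rcases joinedHalf y with _ | ⟨i, c⟩
    · simp [Xor]
    · by_cases h : i = switchIndex x
      · cases b <;> cases inFirstHalf x <;> cases c <;> simp [Xor, h]
      · simp [Xor, h]
  ext u v
  rw [gmSwitch_adj]
  rcases u with x | y <;> rcases v with x' | y'
  · simp only [not_gmSwitched_inl, or_self, Xor, not_false_eq_true, and_true, false_and, or_false]
    rfl
  · rw [gmSwitched_inl_inr]
    simp only [not_gmSwitched_inl, or_false]
    exact key x y'
  · rw [gmSwitched_inl_inr]
    simp only [not_gmSwitched_inl, false_or]
    exact key x' y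
  · simp only [not_gmSwitched_inr, or_self, Xor, not_false_eq_true, and_true, false_and, or_false]
    rcases y with y | y <;> rcases y' with y' | y' <;> rfl

/-- The degrees m + 2 of `HA` and m of `HB` offset the universal parts of sizes m + 5 and m + 7:
attached vertices have 2m + 7 neighbours in their block, which the m + 6 of a half complete to d. -/
theorem sum_adj_AVert (hA : ∀ a, ∑ c, ind (HA.Adj a c) = m + 2) (y : AVert m) :
    ∑ w, ind ((joinComplete HA (Fin (m + 5))).Adj y w) =
      if (joinedHalf (.inl y)).isSome then 2 * m + 7 else 3 * m + 13 := by
  rcases y with (_ | a) | a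
  · rw [sum_joinComplete_inl, hA]
    simp [joinedHalf]; ring
  · rw [sum_joinComplete_inl, hA]
    simp [joinedHalf]; ring
  · have h := sum_joinComplete_inr HA a
    simp only [Fintype.card_option, Fintype.card_prod, Fintype.card_fin] at h
    simp only [joinedHalf, Option.isSome_none, Bool.false_eq_true, if_false]
    omega

theorem sum_adj_BVert (hB : ∀ a, ∑ c, ind (HB.Adj a c) = m) (y : BVert m) :
    ∑ w, ind ((joinComplete HB (Fin (m + 7))).Adj y w) =
      if (joinedHalf (.inr y)).isSome then 2 * m + 7 else 3 * m + 13 := by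
  rcases y with (a | a) | a
  · rw [sum_joinComplete_inl, hB]
    simp [joinedHalf]; ring
  · rw [sum_joinComplete_inl, hB]
    simp [joinedHalf]; ring
  · have h := sum_joinComplete_inr HB a
    simp only [Fintype.card_sum, Fintype.card_fin] at h
    simp only [joinedHalf, Option.isSome_none, Bool.false_eq_true, if_false]
    omega

theorem sum_joinedTo (y : AVert m ⊕ BVert m) :
    ∑ x : PVert m ⊕ QVert m, ind (joinedHalf y = some (switchIndex x, xor b (inFirstHalf x))) =
      if (joinedHalf y).isSome then m + 6 else 0 := by
  rcases joinedHalf y with _ | ⟨i, c⟩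
  · simp
  · refine Eq.trans (Finset.sum_congr rfl fun x _ => ?_) (sum_inFirstHalf (b := b) i c)
    simp [eq_comm (a := i)]

theorem sum_switchGraph_univ (hC : ∀ z, ∑ w, ind (C.Adj z w) = 2) (x : PVert m ⊕ QVert m) :
    ∑ y, ind ((switchGraph C).Adj x y) = 2 * m + 9 := by
  have e0 := sum_switchGraph hC x 0
  have e1 := sum_switchGraph hC x 1
  have h : ∑ y, ind ((switchGraph C).Adj x y) =
      ∑ y, ind (switchIndex y = 0 ∧ (switchGraph C).Adj x y) +
      ∑ y, ind (switchIndex y = 1 ∧ (switchGraph C).Adj x y) := by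
    rw [← Finset.sum_add_distrib]
    refine Finset.sum_congr rfl fun y _ => ?_
    generalize switchIndex y = i
    fin_cases i <;> simp
  rw [h, e0, e1]
  generalize switchIndex x = i
  fin_cases i <;> simp <;> ring

/-- The graph is regular. -/
theorem sum_adj_switchableGraph (hC : ∀ z, ∑ w, ind (C.Adj z w) = 2)
    (hA : ∀ a, ∑ c, ind (HA.Adj a c) = m + 2)
    (hB : ∀ a, ∑ c, ind (HB.Adj a c) = m) (v : Vert m) :
    ∑ w, ind ((switchableGraph C HA HB b).Adj v w) = 3 * m + 13 := by
  rw [Fintype.sum_sum_type]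
  rcases v with x | y | y
  · have h1 := sum_joinedHalf (m := m) (switchIndex x) (xor b (inFirstHalf x))
    have h2 := sum_switchGraph_univ hC x
    simp only [switchableGraph]
    rw [h1, h2]
    ring
  · have h1 := sum_joinedTo (b := b) (.inl y : AVert m ⊕ BVert m)
    have h2 := sum_adj_AVert hA y
    rw [Fintype.sum_sum_type (fun w => ind ((switchableGraph C HA HB b).Adj _ (.inr w)))]
    simp only [switchableGraph, ind_false, Finset.sum_const_zero]
    rw [h1, h2]
    split_ifs <;> ring
  · have h1 := sum_joinedTo (b := b) (.inr y : AVert m ⊕ BVert m)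
    have h2 := sum_adj_BVert hB y
    rw [Fintype.sum_sum_type (fun w => ind ((switchableGraph C HA HB b).Adj _ (.inr w)))]
    simp only [switchableGraph, ind_false, Finset.sum_const_zero]
    rw [h1, h2]
    split_ifs <;> ring

end Construction

/-! ### Counting separated pairs between families of vertices. -/

section SeparatedSums

set_option linter.unusedSectionVars false

variable {V : Type*} [Fintype V] {α β γ : Type*} [Fintype α] [Fintype β] [Fintype γ]

/-- The number of separated pairs with ends in two families of vertices. -/
noncomputable def sepSum (G : SimpleGraph V) (s : V → Bool) (f : α → V) (g : β → V) : ℕ :=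
  ∑ a, ∑ b, sepInd G s (f a) (g b)

variable {G : SimpleGraph V} {s : V → Bool}

theorem sepSum_comm (f : α → V) (g : β → V) : sepSum G s f g = sepSum G s g f := by
  unfold sepSum
  rw [Finset.sum_comm]
  simp only [sepInd_comm G s]

theorem sepSum_sum_left (f : α ⊕ β → V) (g : γ → V) :
    sepSum G s f g = sepSum G s (f ∘ .inl) g + sepSum G s (f ∘ .inr) g :=
  Fintype.sum_sum_type _

theorem sepSum_sum_right (f : α ⊕ β → V) (g : γ → V) :
    sepSum G s g f = sepSum G s g (f ∘ .inl) + sepSum G s g (f ∘ .inr) := by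
  rw [sepSum_comm, sepSum_sum_left, sepSum_comm g, sepSum_comm g]

theorem sepSum_self_sum (f : α ⊕ β → V) :
    sepSum G s f f = sepSum G s (f ∘ .inl) (f ∘ .inl) + 2 * sepSum G s (f ∘ .inl) (f ∘ .inr) +
      sepSum G s (f ∘ .inr) (f ∘ .inr) := by
  rw [sepSum_sum_left, sepSum_sum_right, sepSum_sum_right, sepSum_comm (f ∘ .inr) (f ∘ .inl)]
  ring

theorem sepSum_of_ne {f : α → V} {g : β → V} {c c' : Bool} (hf : ∀ a, s (f a) = c)
    (hg : ∀ b, s (g b) = c') (h : c ≠ c') :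
    sepSum G s f g = ∑ a, ∑ b, ind (G.Adj (f a) (g b)) := by
  unfold sepSum sepInd
  simp [hf, hg, h]

theorem sepSum_of_eq {f : α → V} {g : β → V} {c : Bool} (hf : ∀ a, s (f a) = c)
    (hg : ∀ b, s (g b) = c) : sepSum G s f g = 0 := by
  unfold sepSum sepInd
  simp [hf, hg]

theorem sepSum_of_not_adj {f : α → V} {g : β → V} (h : ∀ a b, ¬ G.Adj (f a) (g b)) :
    sepSum G s f g = 0 := by
  unfold sepSum sepInd
  simp [h]

theorem sum_le_sepSum (f : α → V) (g : β → V) {e : γ → α × β} (he : e.Injective) :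
    ∑ i, sepInd G s (f (e i).1) (g (e i).2) ≤ sepSum G s f g := by
  unfold sepSum
  rw [← Fintype.sum_prod_type']
  refine (Finset.sum_map Finset.univ ⟨e, he⟩
    (fun p : α × β => sepInd G s (f p.1) (g p.2))).symm.trans_le ?_
  exact Finset.sum_le_sum_of_subset (Finset.subset_univ _)

/-- If each vertex of a family has neighbours in two families that lie on different sides of the
cut, then the vertices of the family contribute at least one separated pair each. -/
theorem card_le_sepSum_add_sepSum {δ : Type*} [Fintype δ] {f : α → V} {g : β → V} {h : δ → V}
    {c c' : Bool} (hg : ∀ b, s (g b) = c) (hh : ∀ b, s (h b) = c') (hc : c ≠ c') {x : γ → α}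
    (hx : x.Injective) (y : γ → β) (z : γ → δ)
    (hxy : ∀ i, G.Adj (f (x i)) (g (y i))) (hxz : ∀ i, G.Adj (f (x i)) (h (z i))) :
    Fintype.card γ ≤ sepSum G s f g + sepSum G s f h := by
  have h1 := sum_le_sepSum (G := G) (s := s) f g (e := fun i => (x i, y i))
    fun i j hij => hx (Prod.ext_iff.1 hij).1
  have h2 := sum_le_sepSum (G := G) (s := s) f h (e := fun i => (x i, z i))
    fun i j hij => hx (Prod.ext_iff.1 hij).1
  refine le_trans ?_ (add_le_add h1 h2)
  rw [← Finset.sum_add_distrib, Fintype.card_eq_sum_ones]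
  refine Finset.sum_le_sum fun i _ => ?_
  unfold sepInd
  by_cases h' : s (f (x i)) = c
  · rw [ind_of (p := _ ∧ s (f (x i)) ≠ s (h (z i))) ⟨hxz i, by rw [h', hh]; exact hc⟩]
    omega
  · rw [ind_of (p := _ ∧ s (f (x i)) ≠ s (g (y i))) ⟨hxy i, by rwa [hg]⟩]
    omega

theorem nbrCount_map (f : α ↪ V) (v : V) :
    nbrCount G v (Finset.univ.map f) = ∑ b, ind (G.Adj v (f b)) := by
  rw [nbrCount, Finset.card_filter, Finset.sum_map]
  rfl

/-- The dichotomy that reduces arbitrary colourings to a finite case check: a block is monochromatic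
or pays for being split. -/
theorem const_or_le_sepSum (f : α ↪ V) (a₀ : α) {δ : ℕ}
    (hdeg : ∀ a, δ ≤ ∑ b, ind (G.Adj (f a) (f b))) (hcard : Fintype.card α < 2 * δ + 2) :
    (∃ c, ∀ a, s (f a) = c) ∨ (∀ c, ∃ a, s (f a) = c) ∧ 2 * δ ≤ sepSum G s f f := by
  by_cases h : ∀ a, s (f a) = s (f a₀)
  · exact Or.inl ⟨_, h⟩
  · push Not at h
    obtain ⟨a₁, h₁⟩ := h
    refine Or.inr ⟨fun c => ?_, ?_⟩
    · by_cases hc : s (f a₀) = c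
      · exact ⟨a₀, hc⟩
      · refine ⟨a₁, ?_⟩
        revert h₁ hc
        cases s (f a₀) <;> cases s (f a₁) <;> cases c <;> simp
    · have := le_sum_sepInd_of_split (G := G) (s := s) (δ := δ) (C := Finset.univ.map f)
        (u := f a₁) (v := f a₀) ?_ (by simpa using hcard) (by simp) (by simp) h₁
      · simpa [sepSum, Finset.sum_map] using this
      · intro u hu
        obtain ⟨a, -, rfl⟩ := Finset.mem_map.1 hu
        rw [nbrCount_map]
        exact hdeg a

/-- A cut one side of which is properly contained in a set of at most `d + 1` vertices of a graph
of minimum degree `d` has at least `d` edges. -/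
theorem le_sepSum_of_subset_range {d : ℕ} (hdeg : ∀ u, d ≤ ∑ v, ind (G.Adj u v)) (f : α ↪ V)
    (hcard : Fintype.card α ≤ d + 1) {c : Bool} (hout : ∀ v, (∀ a, f a ≠ v) → s v = c)
    (hf : ∀ c, ∃ a, s (f a) = c) : 2 * d ≤ ∑ u, ∑ v, sepInd G s u v := by
  obtain ⟨a₀, h₀⟩ := hf c
  obtain ⟨a₁, h₁⟩ := hf (!c)
  -- The class of colour `!c` lies in the range of `f` and misses `f a₀`, so it has at most d
  -- vertices.
  refine le_sum_sepInd_of_card_le (C := Finset.univ) (fun u _ => ?_) (!c) ⟨f a₁, by simp [h₁]⟩ ?_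
  · simpa [nbrCount_eq_sum_ind] using hdeg u
  · have hsub : (Finset.univ.filter fun u => s u = !c) ⊆ (Finset.univ.map f).erase (f a₀) := by
      intro v hv
      have hv' := (Finset.mem_filter.1 hv).2
      rw [Finset.mem_erase, Finset.mem_map]
      constructor
      · rintro rfl
        simp [h₀] at hv'
      · by_contra h
        have := hout v fun a ha => h ⟨a, Finset.mem_univ _, ha⟩
        simp [this] at hv'
    have := Finset.card_le_card hsub
    rw [Finset.card_erase_of_mem (by simp)] at this
    simp only [Finset.card_map, Finset.card_univ] at this
    omega

/-- Isolating a vertex of a regular graph. -/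
theorem exists_cut_of_degree {d : ℕ} (hdeg : ∀ u, ∑ v, ind (G.Adj u v) = d) (v₀ v₁ : V)
    (h : v₀ ≠ v₁) : ∃ s : V → Bool, (∃ u, s u = true) ∧ (∃ v, s v = false) ∧
      ∑ u, ∑ v, sepInd G s u v = 2 * d := by
  refine ⟨fun v => decide (v = v₀), ⟨v₀, by simp⟩, ⟨v₁, by simpa using h.symm⟩, ?_⟩
  rw [sum_sepInd, ← hdeg v₀, cutPairs, Finset.card_filter, Fintype.sum_prod_type,
    Finset.sum_eq_single v₀]
  · congr 1
    refine Finset.sum_congr rfl fun v _ => ?_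
    by_cases hv : G.Adj v₀ v
    · simp [hv, hv.ne']
    · simp [hv]
  · intro u _ hu
    simp [hu]
  · simp

end SeparatedSums

/-! ### Contributions of the four blocks to a cut. -/

section Cuts

variable {m : ℕ} {C : SimpleGraph (Option (Fin (m + 6)))}
  {HA : SimpleGraph (Option (Fin 2 × Fin (m + 4)))} {HB : SimpleGraph (Fin (m + 3) ⊕ Fin (m + 4))}

def embP (m : ℕ) : PVert m ↪ Vert m := Function.Embedding.inl.trans Function.Embedding.inl

def embQ (m : ℕ) : QVert m ↪ Vert m := Function.Embedding.inr.trans Function.Embedding.inl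

def embA (m : ℕ) : AVert m ↪ Vert m := Function.Embedding.inl.trans Function.Embedding.inr

def embB (m : ℕ) : BVert m ↪ Vert m := Function.Embedding.inr.trans Function.Embedding.inr

variable {b : Bool} {s : Vert m → Bool}

theorem sum_sepInd_switchableGraph :
    ∑ u, ∑ v, sepInd (switchableGraph C HA HB b) s u v =
      sepSum (switchableGraph C HA HB b) s (embP m) (embP m) +
      sepSum (switchableGraph C HA HB b) s (embQ m) (embQ m) +
      sepSum (switchableGraph C HA HB b) s (embA m) (embA m) +
      sepSum (switchableGraph C HA HB b) s (embB m) (embB m) +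
      2 * (sepSum (switchableGraph C HA HB b) s (embP m) (embA m) +
      sepSum (switchableGraph C HA HB b) s (embP m) (embB m) +
      sepSum (switchableGraph C HA HB b) s (embQ m) (embA m) +
      sepSum (switchableGraph C HA HB b) s (embQ m) (embB m)) := by
  set G := switchableGraph C HA HB b with hG
  have h1 : sepSum G s (embP m) (embQ m) = 0 := sepSum_of_not_adj fun _ _ h => h
  have h2 : sepSum G s (embA m) (embB m) = 0 := sepSum_of_not_adj fun _ _ h => h
  let X : PVert m ⊕ QVert m → Vert m := .inl
  let Y : AVert m ⊕ BVert m → Vert m := .inr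
  have e1 : ∑ u, ∑ v, sepInd G s u v = sepSum G s X X + 2 * sepSum G s X Y + sepSum G s Y Y :=
    sepSum_self_sum id
  have e2 : sepSum G s X X = sepSum G s (embP m) (embP m) + 2 * sepSum G s (embP m) (embQ m) +
      sepSum G s (embQ m) (embQ m) := sepSum_self_sum X
  have e3 : sepSum G s Y Y = sepSum G s (embA m) (embA m) + 2 * sepSum G s (embA m) (embB m) +
      sepSum G s (embB m) (embB m) := sepSum_self_sum Y
  have e4 : sepSum G s X Y = sepSum G s (embP m) Y + sepSum G s (embQ m) Y := sepSum_sum_left X Y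
  have e5 : sepSum G s (embP m) Y = sepSum G s (embP m) (embA m) + sepSum G s (embP m) (embB m) :=
    sepSum_sum_right Y _
  have e6 : sepSum G s (embQ m) Y = sepSum G s (embQ m) (embA m) + sepSum G s (embQ m) (embB m) :=
    sepSum_sum_right Y _
  rw [e1, e2, e3, e4, e5, e6, h1, h2]
  ring

theorem const_or_split_P (hC : ∀ z, ∑ w, ind (C.Adj z w) = 2) :
    (∃ c, ∀ a, s (embP m a) = c) ∨ (∀ c, ∃ a, s (embP m a) = c) ∧
      2 * (2 * m + 9) ≤ sepSum (switchableGraph C HA HB b) s (embP m) (embP m) := by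
  refine const_or_le_sepSum (embP m) (0, none) (fun p => ?_) (by simp; omega)
  have h := sum_switchGraph_univ hC (.inl p)
  rw [Fintype.sum_sum_type] at h
  rw [← h]
  simp [switchGraph, switchableGraph, embP]

theorem const_or_split_Q (hC : ∀ z, ∑ w, ind (C.Adj z w) = 2) :
    (∃ c, ∀ a, s (embQ m a) = c) ∨ (∀ c, ∃ a, s (embQ m a) = c) ∧
      2 * (2 * m + 9) ≤ sepSum (switchableGraph C HA HB b) s (embQ m) (embQ m) := by
  refine const_or_le_sepSum (embQ m) (0, 0) (fun p => ?_) (by simp; omega)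
  have h := sum_switchGraph_univ hC (.inr p)
  rw [Fintype.sum_sum_type] at h
  rw [← h]
  simp [switchGraph, switchableGraph, embQ]

theorem const_or_split_A (hA : ∀ a, ∑ c, ind (HA.Adj a c) = m + 2) :
    (∃ c, ∀ a, s (embA m a) = c) ∨ (∀ c, ∃ a, s (embA m a) = c) ∧
      2 * (2 * m + 7) ≤ sepSum (switchableGraph C HA HB b) s (embA m) (embA m) := by
  refine const_or_le_sepSum (embA m) (.inr 0) (fun y => ?_) (by simp; omega)
  have h : 2 * m + 7 ≤ ∑ w, ind ((joinComplete HA (Fin (m + 5))).Adj y w) := by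
    rw [sum_adj_AVert hA]
    split_ifs <;> omega
  exact h

theorem const_or_split_B (hB : ∀ a, ∑ c, ind (HB.Adj a c) = m) :
    (∃ c, ∀ a, s (embB m a) = c) ∨ (∀ c, ∃ a, s (embB m a) = c) ∧
      2 * (2 * m + 7) ≤ sepSum (switchableGraph C HA HB b) s (embB m) (embB m) := by
  refine const_or_le_sepSum (embB m) (.inr 0) (fun y => ?_) (by simp; omega)
  have h : 2 * m + 7 ≤ ∑ w, ind ((joinComplete HB (Fin (m + 7))).Adj y w) := by
    rw [sum_adj_BVert hB]
    split_ifs <;> omega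
  exact h

theorem edges_PA_false :
    ∑ p, ∑ a, ind ((switchableGraph C HA HB false).Adj (embP m p) (embA m a)) =
      2 * ((m + 6) * (m + 4)) + 1 := by
  simp [switchableGraph, embP, embA, Fintype.sum_prod_type]
  ring

/-- Only (0, none) and (1, none) reach B, with m + 3 and m + 4 edges. -/
theorem edges_PB_false :
    ∑ p, ∑ a, ind ((switchableGraph C HA HB false).Adj (embP m p) (embB m a)) = 2 * m + 7 := by
  simp [switchableGraph, embP, embB, Fintype.sum_prod_type]
  ring

/-- Only the exceptional vertex of A reaches Q, in layer 0. -/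
theorem edges_QA_false :
    ∑ p, ∑ a, ind ((switchableGraph C HA HB false).Adj (embQ m p) (embA m a)) = m + 5 := by
  simp [switchableGraph, embQ, embA, Fintype.sum_prod_type]

theorem edges_QB_false :
    ∑ p, ∑ a, ind ((switchableGraph C HA HB false).Adj (embQ m p) (embB m a)) =
      (m + 5) * (2 * m + 7) := by
  simp [switchableGraph, embQ, embB, Fintype.sum_prod_type]
  ring

/-- Each (i, none) contributes m + 4 edges, and the exceptional vertex of A contributes m + 6. -/
theorem edges_PA_true :
    ∑ p, ∑ a, ind ((switchableGraph C HA HB true).Adj (embP m p) (embA m a)) = 3 * m + 14 := by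
  simp [switchableGraph, embP, embA, Fintype.sum_prod_type]
  ring

theorem edges_PB_true :
    ∑ p, ∑ a, ind ((switchableGraph C HA HB true).Adj (embP m p) (embB m a)) =
      (m + 6) * (2 * m + 7) := by
  simp [switchableGraph, embP, embB, Fintype.sum_prod_type]
  ring

theorem edges_QA_true :
    ∑ p, ∑ a, ind ((switchableGraph C HA HB true).Adj (embQ m p) (embA m a)) =
      2 * ((m + 5) * (m + 4)) := by
  simp [switchableGraph, embQ, embA, Fintype.sum_prod_type]
  ring

end Cuts

/-! ### Lower bounds for all cuts, and the small cut. -/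

section Connectivity

variable {m : ℕ} {C : SimpleGraph (Option (Fin (m + 6)))}
  {HA : SimpleGraph (Option (Fin 2 × Fin (m + 4)))} {HB : SimpleGraph (Fin (m + 3) ⊕ Fin (m + 4))}
  {b : Bool} {s : Vert m → Bool}

/-- When the other blocks share one colour, no edges between blocks are forced; instead one side of
the cut lies properly inside the split block, which has at most d + 1 vertices. The same holds for
the other three blocks. -/
theorem le_cut_of_split_P {d : ℕ} {G : SimpleGraph (Vert m)} (hd : ∀ u, ∑ v, ind (G.Adj u v) = d)
    (hm : 2 * m + 13 ≤ d) {c : Bool} (hP : ∀ c, ∃ a, s (embP m a) = c)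
    (hQ : ∀ a, s (embQ m a) = c) (hA : ∀ a, s (embA m a) = c) (hB : ∀ a, s (embB m a) = c) :
    2 * d ≤ ∑ u, ∑ v, sepInd G s u v := by
  refine le_sepSum_of_subset_range (c := c) (fun u => (hd u).ge) (embP m) (by simp; omega) ?_ hP
  rintro ((v | v) | v | v) hv
  exacts [(hv v rfl).elim, hQ v, hA v, hB v]

theorem le_cut_of_split_Q {d : ℕ} {G : SimpleGraph (Vert m)} (hd : ∀ u, ∑ v, ind (G.Adj u v) = d)
    (hm : 2 * m + 9 ≤ d) {c : Bool} (hQ : ∀ c, ∃ a, s (embQ m a) = c)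
    (hP : ∀ a, s (embP m a) = c) (hA : ∀ a, s (embA m a) = c) (hB : ∀ a, s (embB m a) = c) :
    2 * d ≤ ∑ u, ∑ v, sepInd G s u v := by
  refine le_sepSum_of_subset_range (c := c) (fun u => (hd u).ge) (embQ m) (by simp; omega) ?_ hQ
  rintro ((v | v) | v | v) hv
  exacts [hP v, (hv v rfl).elim, hA v, hB v]

theorem le_cut_of_split_A {d : ℕ} {G : SimpleGraph (Vert m)} (hd : ∀ u, ∑ v, ind (G.Adj u v) = d)
    (hm : 3 * m + 13 ≤ d) {c : Bool} (hA : ∀ c, ∃ a, s (embA m a) = c)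
    (hP : ∀ a, s (embP m a) = c) (hQ : ∀ a, s (embQ m a) = c) (hB : ∀ a, s (embB m a) = c) :
    2 * d ≤ ∑ u, ∑ v, sepInd G s u v := by
  refine le_sepSum_of_subset_range (c := c) (fun u => (hd u).ge) (embA m) (by simp; omega) ?_ hA
  rintro ((v | v) | v | v) hv
  exacts [hP v, hQ v, (hv v rfl).elim, hB v]

theorem le_cut_of_split_B {d : ℕ} {G : SimpleGraph (Vert m)} (hd : ∀ u, ∑ v, ind (G.Adj u v) = d)
    (hm : 3 * m + 13 ≤ d) {c : Bool} (hB : ∀ c, ∃ a, s (embB m a) = c)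
    (hP : ∀ a, s (embP m a) = c) (hQ : ∀ a, s (embQ m a) = c) (hA : ∀ a, s (embA m a) = c) :
    2 * d ≤ ∑ u, ∑ v, sepInd G s u v := by
  refine le_sepSum_of_subset_range (c := c) (fun u => (hd u).ge) (embB m) (by simp; omega) ?_ hB
  rintro ((v | v) | v | v) hv
  exacts [hP v, hQ v, hA v, (hv v rfl).elim]

theorem le_cut_false (hC : ∀ z, ∑ w, ind (C.Adj z w) = 2)
    (hA : ∀ a, ∑ c, ind (HA.Adj a c) = m + 2) (hB : ∀ a, ∑ c, ind (HB.Adj a c) = m)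
    (ht : ∃ u, s u = true) (hf : ∃ v, s v = false) :
    2 * (3 * m + 12) ≤ ∑ u, ∑ v, sepInd (switchableGraph C HA HB false) s u v := by
  have hd := sum_adj_switchableGraph (b := false) hC hA hB
  have hsum := sum_sepInd_switchableGraph (C := C) (HA := HA) (HB := HB) (b := false) (s := s)
  have hP := const_or_split_P (HA := HA) (HB := HB) (b := false) (s := s) hC
  have hQ := const_or_split_Q (HA := HA) (HB := HB) (b := false) (s := s) hC
  have hA' := const_or_split_A (C := C) (HB := HB) (b := false) (s := s) hA
  have hB' := const_or_split_B (C := C) (HA := HA) (b := false) (s := s) hB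
  have hPA : ∀ c c', (∀ a, s (embP m a) = c) → (∀ a, s (embA m a) = c') → c ≠ c' →
      3 * m + 13 ≤ sepSum (switchableGraph C HA HB false) s (embP m) (embA m) := by
    intro c c' h h' hne
    rw [sepSum_of_ne h h' hne, edges_PA_false]
    nlinarith
  have hQB : ∀ c c', (∀ a, s (embQ m a) = c) → (∀ a, s (embB m a) = c') → c ≠ c' →
      3 * m + 13 ≤ sepSum (switchableGraph C HA HB false) s (embQ m) (embB m) := by
    intro c c' h h' hne
    rw [sepSum_of_ne h h' hne, edges_QB_false]
    nlinarith
  have hQA : ∀ c c', (∀ a, s (embQ m a) = c) → (∀ a, s (embA m a) = c') → c ≠ c' →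
      m + 5 ≤ sepSum (switchableGraph C HA HB false) s (embQ m) (embA m) := by
    intro c c' h h' hne
    rw [sepSum_of_ne h h' hne, edges_QA_false]
  have hPB : ∀ c c', (∀ a, s (embP m a) = c) → (∀ a, s (embB m a) = c') → c ≠ c' →
      2 * m + 7 ≤ sepSum (switchableGraph C HA HB false) s (embP m) (embB m) := by
    intro c c' h h' hne
    rw [sepSum_of_ne h h' hne, edges_PB_false]
  -- Two split blocks already cost at least 4m + 14 edges; `omega` leaves the patterns with at most
  -- one split block.
  rcases hP with ⟨p, hp⟩ | ⟨hp, hp'⟩ <;> rcases hQ with ⟨q, hq⟩ | ⟨hq, hq'⟩ <;>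
    rcases hA' with ⟨x, hx⟩ | ⟨hx, hx'⟩ <;> rcases hB' with ⟨y, hy⟩ | ⟨hy, hy'⟩ <;> try omega
  · by_cases h1 : p = x
    · by_cases h2 : q = y
      · subst h1 h2
        have h3 : p ≠ q := by
          rintro rfl
          have : ∀ v, s v = p := by
            rintro ((v | v) | v | v)
            exacts [hp v, hq v, hx v, hy v]
          obtain ⟨u, hu⟩ := ht
          obtain ⟨v, hv⟩ := hf
          rw [this] at hu hv
          simp [hu] at hv
        have := hQA q p hq hx h3.symm
        have := hPB p q hp hy h3
        omega
      · have := hQB q y hq hy h2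
        omega
    · have := hPA p x hp hx h1
      omega
  · by_cases h1 : p = x
    · subst h1
      by_cases h2 : q = p
      · subst h2
        have := le_cut_of_split_B hd le_rfl hy hp hq hx
        omega
      -- A tight case: 2m + 7 for splitting B and m + 5 between Q and A give exactly 3m + 12.
      · have := hQA q p hq hx h2
        omega
    · have := hPA p x hp hx h1
      omega
  · by_cases h1 : q = y
    · subst h1
      by_cases h2 : p = q
      · subst h2
        have := le_cut_of_split_A hd le_rfl hx hp hq hy
        omega
      · have := hPB p q hp hy h2
        omega
    · have := hQB q y hq hy h1
      omega
  · by_cases h1 : p = x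
    · subst h1
      by_cases h2 : p = y
      · subst h2
        have := le_cut_of_split_Q hd (by omega) hq hp hx hy
        omega
      · have := hPB p y hp hy h2
        omega
    · have := hPA p x hp hx h1
      omega
  · by_cases h1 : q = y
    · subst h1
      by_cases h2 : q = x
      · subst h2
        have := le_cut_of_split_P hd (by omega) hp hq hx hy
        omega
      · have := hQA q x hq hx h2
        omega
    · have := hQB q y hq hy h1
      omega

theorem le_cut_true (hC : ∀ z, ∑ w, ind (C.Adj z w) = 2)
    (hA : ∀ a, ∑ c, ind (HA.Adj a c) = m + 2) (hB : ∀ a, ∑ c, ind (HB.Adj a c) = m)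
    (ht : ∃ u, s u = true) (hf : ∃ v, s v = false) :
    2 * (3 * m + 13) ≤ ∑ u, ∑ v, sepInd (switchableGraph C HA HB true) s u v := by
  have hd := sum_adj_switchableGraph (b := true) hC hA hB
  have hsum := sum_sepInd_switchableGraph (C := C) (HA := HA) (HB := HB) (b := true) (s := s)
  have hP := const_or_split_P (HA := HA) (HB := HB) (b := true) (s := s) hC
  have hQ := const_or_split_Q (HA := HA) (HB := HB) (b := true) (s := s) hC
  have hA' := const_or_split_A (C := C) (HB := HB) (b := true) (s := s) hA
  have hB' := const_or_split_B (C := C) (HA := HA) (b := true) (s := s) hB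
  have hPA : ∀ c c', (∀ a, s (embP m a) = c) → (∀ a, s (embA m a) = c') → c ≠ c' →
      3 * m + 14 ≤ sepSum (switchableGraph C HA HB true) s (embP m) (embA m) := by
    intro c c' h h' hne
    rw [sepSum_of_ne h h' hne, edges_PA_true]
  have hPB : ∀ c c', (∀ a, s (embP m a) = c) → (∀ a, s (embB m a) = c') → c ≠ c' →
      3 * m + 13 ≤ sepSum (switchableGraph C HA HB true) s (embP m) (embB m) := by
    intro c c' h h' hne
    rw [sepSum_of_ne h h' hne, edges_PB_true]
    nlinarith
  have hQA : ∀ c c', (∀ a, s (embQ m a) = c) → (∀ a, s (embA m a) = c') → c ≠ c' →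
      3 * m + 13 ≤ sepSum (switchableGraph C HA HB true) s (embQ m) (embA m) := by
    intro c c' h h' hne
    rw [sepSum_of_ne h h' hne, edges_QA_true]
    nlinarith
  -- The vertices (0, some i) have neighbours in both A and B, so each is separated from one of
  -- them. This serves when P is split, adding m + 6 to the 2m + 9 for the split.
  have hAB : ∀ c c', (∀ a, s (embA m a) = c) → (∀ a, s (embB m a) = c') → c ≠ c' →
      m + 6 ≤ sepSum (switchableGraph C HA HB true) s (embP m) (embA m) +
        sepSum (switchableGraph C HA HB true) s (embP m) (embB m) := by
    intro c c' h h' hne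
    have := card_le_sepSum_add_sepSum (G := switchableGraph C HA HB true) (f := embP m) h h' hne
      (x := fun i : Fin (m + 6) => (0, some i)) (fun i j hij => by simpa using hij)
      (fun _ => .inl none) (fun _ => .inl (.inl 0)) (fun i => ?_) (fun i => ?_)
    · simpa using this
    · simp [switchableGraph, embP, embA]
    · simp [switchableGraph, embP, embB]
  -- Each of the 2m + 8 non-exceptional attached vertices of A has neighbours in both P and Q. This
  -- serves when A is split, as there are no edges between Q and B to count.
  have hPQ : ∀ c c', (∀ a, s (embP m a) = c) → (∀ a, s (embQ m a) = c') → c ≠ c' →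
      2 * m + 8 ≤ sepSum (switchableGraph C HA HB true) s (embP m) (embA m) +
        sepSum (switchableGraph C HA HB true) s (embQ m) (embA m) := by
    intro c c' h h' hne
    have := card_le_sepSum_add_sepSum (G := switchableGraph C HA HB true) (f := embA m) h h' hne
      (x := fun i : Fin 2 × Fin (m + 4) => .inl (some i)) (fun i j hij => by simpa using hij)
      (fun i => (i.1, none)) (fun i => (i.1, 0)) (fun i => ?_) (fun i => ?_)
    · rw [sepSum_comm (embA m), sepSum_comm (embA m)] at this
      simp only [Fintype.card_prod, Fintype.card_fin] at this
      omega
    · simp [switchableGraph, embP, embA]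
    · simp [switchableGraph, embQ, embA]
  rcases hP with ⟨p, hp⟩ | ⟨hp, hp'⟩ <;> rcases hQ with ⟨q, hq⟩ | ⟨hq, hq'⟩ <;>
    rcases hA' with ⟨x, hx⟩ | ⟨hx, hx'⟩ <;> rcases hB' with ⟨y, hy⟩ | ⟨hy, hy'⟩ <;> try omega
  · by_cases h1 : q = x
    · by_cases h2 : p = y
      · subst h1 h2
        have h3 : p ≠ q := by
          rintro rfl
          have : ∀ v, s v = p := by
            rintro ((v | v) | v | v)
            exacts [hp v, hq v, hx v, hy v]
          obtain ⟨u, hu⟩ := ht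
          obtain ⟨v, hv⟩ := hf
          rw [this] at hu hv
          simp [hu] at hv
        have := hPA p q hp hx h3
        omega
      · have := hPB p y hp hy h2
        omega
    · have := hQA q x hq hx h1
      omega
  · by_cases h1 : q = x
    · subst h1
      by_cases h2 : p = q
      · subst h2
        have := le_cut_of_split_B hd le_rfl hy hp hq hx
        omega
      · have := hPA p q hp hx h2
        omega
    · have := hQA q x hq hx h1
      omega
  · by_cases h1 : p = y
    · subst h1
      by_cases h2 : p = q
      · subst h2
        have := le_cut_of_split_A hd le_rfl hx hp hq hy
        omega
      · have := hPQ p q hp hq h2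
        omega
    · have := hPB p y hp hy h1
      omega
  · by_cases h1 : p = y
    · subst h1
      by_cases h2 : p = x
      · subst h2
        have := le_cut_of_split_Q hd (by omega) hq hp hx hy
        omega
      · have := hPA p x hp hx h2
        omega
    · have := hPB p y hp hy h1
      omega
  · by_cases h1 : q = x
    · subst h1
      by_cases h2 : q = y
      · subst h2
        have := le_cut_of_split_P hd (by omega) hp hq hx hy
        omega
      · have := hAB q y hx hy h2
        omega
    · have := hQA q x hq hx h1
      omega

/-- The small cut that appears on one side of the switching. -/
theorem exists_cut_false : ∃ s : Vert m → Bool, (∃ u, s u = true) ∧ (∃ v, s v = false) ∧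
    ∑ u, ∑ v, sepInd (switchableGraph C HA HB false) s u v = 2 * (3 * m + 12) := by
  let s : Vert m → Bool :=
    Sum.elim (Sum.elim (fun _ => true) fun _ => false) (Sum.elim (fun _ => true) fun _ => false)
  have hP : ∀ a, s (embP m a) = true := fun _ => rfl
  have hQ : ∀ a, s (embQ m a) = false := fun _ => rfl
  have hA : ∀ a, s (embA m a) = true := fun _ => rfl
  have hB : ∀ a, s (embB m a) = false := fun _ => rfl
  refine ⟨s, ⟨_, hP (0, none)⟩, ⟨_, hQ (0, 0)⟩, ?_⟩
  rw [sum_sepInd_switchableGraph, sepSum_of_eq hP hP, sepSum_of_eq hQ hQ, sepSum_of_eq hA hA,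
    sepSum_of_eq hB hB, sepSum_of_eq hP hA, sepSum_of_eq hQ hB, sepSum_of_ne hP hB (by simp),
    sepSum_of_ne hQ hA (by simp), edges_PB_false, edges_QA_false]
  ring

end Connectivity

/-! ### Transport along a bijection of vertex sets. -/

section Transfer

variable {V W : Type*} {n : ℕ} {G : SimpleGraph V} {X : Fin n → Finset V}

/-- The preimages of the switching sets under a bijection. -/
def pullSets (e : W ≃ V) (X : Fin n → Finset V) (i : Fin n) : Finset W :=
  (X i).map e.symm.toEmbedding

theorem mem_pullSets (e : W ≃ V) {i : Fin n} {w : W} : w ∈ pullSets e X i ↔ e w ∈ X i := by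
  simp [pullSets]

theorem card_pullSets (e : W ≃ V) (i : Fin n) : (pullSets e X i).card = (X i).card :=
  Finset.card_map _

theorem nbrCount_pullSets (e : W ≃ V) (w : W) (i : Fin n) :
    nbrCount (G.comap e) w (pullSets e X i) = nbrCount G (e w) (X i) := by
  unfold nbrCount
  rw [pullSets, Finset.filter_map, Finset.card_map]
  congr 1
  ext v
  simp

theorem forall_notMem_pullSets (e : W ≃ V) (w : W) :
    (∀ j, w ∉ pullSets e X j) ↔ ∀ j, e w ∉ X j := by
  simp only [mem_pullSets]

theorem IsGMPartition.comap (h : IsGMPartition G X) (e : W ≃ V) :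
    IsGMPartition (G.comap e) (pullSets e X) where
  nonempty i := (h.nonempty i).map
  disjoint i j hij := (Finset.disjoint_map _).2 (h.disjoint i j hij)
  equitable i j x hx x' hx' := by
    rw [mem_pullSets] at hx hx'
    rw [nbrCount_pullSets, nbrCount_pullSets, h.equitable i j _ hx _ hx']
  half i y hy := by
    rw [nbrCount_pullSets, card_pullSets]
    exact h.half i _ ((forall_notMem_pullSets e y).1 hy)

theorem gmSwitch_comap (e : W ≃ V) :
    gmSwitch (G.comap e) (pullSets e X) = (gmSwitch G X).comap e := by
  have key : ∀ u v, GMSwitched (G.comap e) (pullSets e X) u v ↔ GMSwitched G X (e u) (e v) := by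
    intro u v
    simp only [GMSwitched, mem_pullSets, nbrCount_pullSets, card_pullSets]
  ext u v
  rw [SimpleGraph.comap_adj, gmSwitch_adj, gmSwitch_adj, key, key, SimpleGraph.comap_adj]

variable [Fintype V] [Fintype W]

theorem sum_sepInd_comap (e : W ≃ V) (s : V → Bool) :
    ∑ u, ∑ v, sepInd (G.comap e) (s ∘ e) u v = ∑ u, ∑ v, sepInd G s u v := by
  rw [← Equiv.sum_comp e]
  refine Finset.sum_congr rfl fun u _ => ?_
  rw [← Equiv.sum_comp e]
  rfl

theorem isEdgeConnectivity_comap (e : W ≃ V) {c : ℕ}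
    (hle : ∀ s : V → Bool, (∃ u, s u = true) → (∃ v, s v = false) →
      2 * c ≤ ∑ u, ∑ v, sepInd G s u v)
    (hex : ∃ s : V → Bool, (∃ u, s u = true) ∧ (∃ v, s v = false) ∧
      ∑ u, ∑ v, sepInd G s u v = 2 * c) : IsEdgeConnectivity (G.comap e) c := by
  refine isEdgeConnectivity_of_colouring ?_ ?_
  · rintro s ⟨u, hu⟩ ⟨v, hv⟩
    have h := hle (s ∘ e.symm) ⟨e u, by simpa⟩ ⟨e v, by simpa⟩
    rw [← sum_sepInd_comap e] at h
    simpa [Function.comp_assoc] using h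
  · obtain ⟨s, ⟨u, hu⟩, ⟨v, hv⟩, h⟩ := hex
    exact ⟨s ∘ e, ⟨e.symm u, by simpa⟩, ⟨e.symm v, by simpa⟩, by rw [sum_sepInd_comap, h]⟩

theorem isRegularOfDegree_comap (e : W ≃ V) {d : ℕ} (hd : ∀ u, ∑ v, ind (G.Adj u v) = d) :
    (G.comap e).IsRegularOfDegree d := by
  intro w
  rw [← hd (e w), ← Equiv.sum_comp e, ← SimpleGraph.card_neighborFinset_eq_degree,
    card_eq_sum_ind]
  simp

end Transfer

/-! ### Assembly of the theorem. -/

theorem theorem3 (k : ℕ) (hk : 6 ≤ k) (hk2 : Even k) :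
    ∃ (G : SimpleGraph (Fin (10 * k - 8))) (X : Fin 2 → Finset (Fin (10 * k - 8))),
      IsGMPartition G X ∧
      -- each of the two sets is really switched with respect to some outside vertex
      (∀ i, ∃ y, (∀ j, y ∉ X j) ∧ 2 * nbrCount G y (X i) = (X i).card) ∧
      G.IsRegularOfDegree (3 * k - 5) ∧
      (gmSwitch G X).IsRegularOfDegree (3 * k - 5) ∧
      adjSpectrum G = adjSpectrum (gmSwitch G X) ∧
      IsEdgeConnectivity G (3 * k - 5) ∧
      IsEdgeConnectivity (gmSwitch G X) (3 * k - 6) := by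
  -- Evenness of k makes the order m + 7 of `C` odd and the degrees m + 2 and m even, as
  -- `exists_regular_graph` needs; k ≥ 6 keeps the degree m = k − 6 of `HB` nonnegative.
  obtain ⟨j, hj⟩ : ∃ j, k = 2 * j + 6 := by
    obtain ⟨r, hr⟩ := hk2
    exact ⟨r - 3, by omega⟩
  set m := 2 * j with hm
  obtain ⟨C, hC⟩ := exists_regular_graph (α := Option (Fin (m + 6))) (j := 1)
    (by simp only [Fintype.card_option, Fintype.card_fin]; exact ⟨j + 3, by omega⟩)
    (by simp only [Fintype.card_option, Fintype.card_fin]; omega)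
  obtain ⟨HA, hA⟩ := exists_regular_graph (α := Option (Fin 2 × Fin (m + 4))) (j := j + 1)
    (by simp only [Fintype.card_option, Fintype.card_prod, Fintype.card_fin]
        exact ⟨m + 4, by omega⟩)
    (by simp only [Fintype.card_option, Fintype.card_prod, Fintype.card_fin]; omega)
  obtain ⟨HB, hB⟩ := exists_regular_graph (α := Fin (m + 3) ⊕ Fin (m + 4)) (j := j)
    (by simp only [Fintype.card_sum, Fintype.card_fin]; exact ⟨m + 3, by omega⟩)
    (by simp only [Fintype.card_sum, Fintype.card_fin]; omega)
  rw [mul_add_one, ← hm] at hA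
  rw [← hm] at hB
  let e : Fin (10 * k - 8) ≃ Vert m := Fintype.equivOfCardEq (by simp; omega)
  have hGM : IsGMPartition (switchableGraph C HA HB true) (switchSets m) :=
    isGMPartition_switchSets hC
  have hsw : gmSwitch ((switchableGraph C HA HB true).comap e) (pullSets e (switchSets m)) =
      (switchableGraph C HA HB false).comap e := by
    rw [gmSwitch_comap, gmSwitch_switchableGraph]
    rfl
  rw [show 3 * k - 5 = 3 * m + 13 by omega, show 3 * k - 6 = 3 * m + 12 by omega]
  refine ⟨(switchableGraph C HA HB true).comap e, pullSets e (switchSets m), hGM.comap e,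
    fun i => ?_, isRegularOfDegree_comap e (sum_adj_switchableGraph hC hA hB), ?_,
    (hGM.comap e).adjSpectrum_gmSwitch, ?_, ?_⟩
  · obtain ⟨y, hy, hy'⟩ := exists_half_switchSets (C := C) (HA := HA) (HB := HB) (b := true) i
    refine ⟨e.symm y, ?_, ?_⟩
    · rw [forall_notMem_pullSets]
      simpa using hy
    · rw [nbrCount_pullSets, card_pullSets]
      simpa using hy'
  · rw [hsw]
    exact isRegularOfDegree_comap e (sum_adj_switchableGraph hC hA hB)
  · exact isEdgeConnectivity_comap e (fun s => le_cut_true hC hA hB)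
      (exists_cut_of_degree (sum_adj_switchableGraph hC hA hB) (.inl (.inl (0, none)))
        (.inl (.inl (1, none))) (by simp))
  · rw [hsw]
    exact isEdgeConnectivity_comap e (fun s => le_cut_false hC hA hB) exists_cut_false
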